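/- Let $\Omega=\{H,T\}^{\mathbb N}$ with its product $\sigma$-algebra and coordinates $X_0,X_1,\dots$. For $\theta\in[0,1]$ let $\beta_\theta$ be the law of iid tosses with probability $\theta$ of heads. Let $S$ be the set of $2\times2$ row-stochastic matrices $P$ with exactly one stationary distribution (that is, $P\neq I$), and for $P\in S$ let $\gamma_P$ be the law of the Markov chain with transition matrix $P$ started from its stationary distribution. A probability measure $\nu$ on $\Omega$ is *exchangeable* if $\nu(X_0=x_0,\dots,X_{n-1}=x_{n-1})=\nu(X_{\pi(0)}=x_0,\dots,X_{\pi(n-1)}=x_{n-1})$ for all words and permutations $\pi$; it is *Markov exchangeable* if the probability of a finite initial word depends only on its first letter and its numbers of transitions $a\to b$; it is *stationary* if it is invariant under the shift. A measure $\mu$ on $\Omega$ is *computable* if the measures of the cylinders are uniformly computable reals. A *Martin-Löf test* for $\mu$ is a uniformly computably enumerable sequence of open sets $U_n$ with $\mu(U_n)\le2^{-n}$; a history is *Martin-Löf random* for $\mu$ if it lies in $\bigcap_nU_n$ for no test $(U_n)$. Let $L^\star$ be the set of histories that are Martin-Löf random for $\beta_{0.5}$. Let $P_M\in S$ be such that $\gamma_{P_M}$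 is computable, and let $M^\star$ be the set of histories that are Martin-Löf random for $\gamma_{P_M}$. Let $w_I,w_M\ge0$ with $w_I+w_M=1$, and let the prior be $Cr=w_I\nu_I+w_M\nu_M$ where either (a) $\nu_I$ is any exchangeable and $\nu_M$ any stationary Markov exchangeable probability measure; or (b) $\nu_I=\int_0^1\beta_\theta\,d\mu_I(\theta)$ and $\nu_M=\int_S\gamma_P\,d\mu_S(P)$ for probability measures $\mu_I$ on $[0,1]$ and $\mu_S$ on $S$. Then, in both cases: 1. If $Cr(M^\star)>0$, then $Cr(\,\cdot\mid M^\star)=\gamma_{P_M}$. 2. If $\gamma_{P_M}$ is not one of the measures $\beta_\theta$, then $\nu_I(M^\star)=0$, so the exchangeable model has posterior weight $0$ given $M^\star$. 3. (Resilience.) If $Cr(M^\star\cap\{X_0=x_0,\dots,X_n=x_n\})>0$, then for every measurable $A\subseteq\Omega$ $$Cr\big((X_{n+1},X_{n+2},\dots)\in A\mid M^\star,X_0=x_0,\dots,X_n=x_n\big)=Cr\big((X_{n+1},X_{n+2},\dots)\in A\mid M^\star,X_n=x_n\big).$$ 4. If $Cr(L^\star)>0$, then $Cr(\,\cdot\mid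 L^\star)=\beta_{0.5}$. Moreover, in case (b), if $\mu_S(\{P:\gamma_P=\beta_{0.5}\})=0$, then $\nu_M(L^\star)=0$, so the Markov model has posterior weight $0$ given $L^\star$. -/

import Mathlib

open MeasureTheory ProbabilityTheory
open scoped ENNReal unitInterval

/-- Infinite histories of tosses: `true` is heads, `false` is tails. It carries the product
`σ`-algebra. -/
abbrev History : Type := ℕ → Bool

/-- The histories that begin with the finite word `x`. -/
def cylinderOf {n : ℕ} (x : Fin n → Bool) : Set History := {ω | ∀ i : Fin n, ω i = x i}

/-- The histories that begin with the binary string `s`. -/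
def cylinderOfString (s : List Bool) : Set History := cylinderOf s.get

/-- The time shift by `m` steps. -/
def timeShift (m : ℕ) (ω : History) : History := fun k => ω (m + k)

/-! ### Symmetries of credences -/

/-- Exchangeability:
`ν (X₁ = x₁, …, Xₙ = xₙ) = ν (X_{π 1} = x₁, …, X_{π n} = xₙ)` for all words and permutations. -/
def IsExchangeable (ν : Measure History) : Prop :=
  ∀ (n : ℕ) (x : Fin n → Bool) (π : Equiv.Perm (Fin n)),
    ν {ω | ∀ i : Fin n, ω i = x i} = ν {ω | ∀ i : Fin n, ω (π i) = x i}

/-- The number of transitions from `a` to `b` in the word `x 0, …, x n`. -/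
def transitionCount {n : ℕ} (x : Fin (n + 1) → Bool) (a b : Bool) : ℕ :=
  (Finset.univ.filter fun i : Fin n => x i.castSucc = a ∧ x i.succ = b).card

/-- Markov exchangeability: the probability of a word depends only on its first letter and on its
transition counts. -/
def IsMarkovExchangeable (ν : Measure History) : Prop :=
  ∀ (n : ℕ) (x y : Fin (n + 1) → Bool), x 0 = y 0 →
    (∀ a b, transitionCount x a b = transitionCount y a b) →
    ν (cylinderOf x) = ν (cylinderOf y)

/-- Stationarity: invariance of the law under the time shift. -/
def HasStationaryLaw (ν : Measure History) : Prop :=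
  MeasurePreserving (timeShift 1) ν ν

/-! ### The iid measures `β_θ` and the stationary Markov measures `γ_P` -/

/-- The iid measure `β_θ` on histories, with probability `θ` of heads. -/
noncomputable def iidMeasure (θ : I) : Measure History :=
  Measure.infinitePi fun _ : ℕ => bernoulliMeasure true false θ

/-- The probability `1 / 2`, as a point of the unit interval. -/
noncomputable def halfProb : I := ⟨1 / 2, by norm_num, by norm_num⟩

/-- `p` is a stationary distribution of the transition matrix `P`. -/
def IsStationaryDistribution (P : Matrix Bool Bool ℝ) (p : Bool → ℝ) : Prop :=
  p ∈ stdSimplex ℝ Bool ∧ Matrix.vecMul p P = p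

/-- The space `S` of the two-state transition matrices that induce a stationary Markov measure:
the row-stochastic matrices with exactly one stationary distribution (for two states, this is every
row-stochastic matrix except the identity). -/
def TransitionMatrix : Type :=
  {P : Matrix Bool Bool ℝ //
    P ∈ Matrix.rowStochastic ℝ Bool ∧ ∃! p : Bool → ℝ, IsStationaryDistribution P p}

/-- The Borel `σ`-algebra of `S`, as a subspace of the real `2 × 2` matrices. -/
instance TransitionMatrix.instMeasurableSpace : MeasurableSpace TransitionMatrix :=
  inferInstanceAs (MeasurableSpace {P : Bool → Bool → ℝ //
    P ∈ Matrix.rowStochastic ℝ Bool ∧ ∃! p : Bool → ℝ, IsStationaryDistribution P p})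

/-- The measure on `Bool` with weights `p`. -/
noncomputable def weightMeasure (p : Bool → ℝ) : Measure Bool :=
  ∑ b : Bool, ENNReal.ofReal (p b) • Measure.dirac b

theorem isProbabilityMeasure_weightMeasure {p : Bool → ℝ} (hp : p ∈ stdSimplex ℝ Bool) :
    IsProbabilityMeasure (weightMeasure p) := by
  constructor
  simp only [weightMeasure, Measure.coe_finsetSum, Measure.coe_smul, Finset.sum_apply,
    Pi.smul_apply, measure_univ, smul_eq_mul, mul_one]
  rw [← ENNReal.ofReal_sum_of_nonneg fun b _ => hp.1 b, hp.2, ENNReal.ofReal_one]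

namespace TransitionMatrix

/-- The stationary distribution of `P`. -/
noncomputable def stationaryDistribution (P : TransitionMatrix) : Bool → ℝ :=
  P.2.2.choose

/-- One step of the chain: from state `a`, move to `b` with probability `P a b`. -/
noncomputable def stepKernel (P : TransitionMatrix) : Kernel Bool Bool where
  toFun a := weightMeasure (P.1 a)
  measurable' := measurable_from_top

instance instIsMarkovKernelStepKernel (P : TransitionMatrix) : IsMarkovKernel P.stepKernel :=
  ⟨fun a => isProbabilityMeasure_weightMeasure
    ⟨P.2.1.1 a, (Matrix.mem_rowStochastic_iff_sum.1 P.2.1).2 a⟩⟩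

/-- The step from time `n` to time `n + 1`; it depends on the past only through the state at
time `n`. -/
noncomputable def stepAt (P : TransitionMatrix) (n : ℕ) :
    Kernel ((i : Finset.Iic n) → (fun _ : ℕ => Bool) i) ((fun _ : ℕ => Bool) (n + 1)) :=
  P.stepKernel.comap (fun x => x ⟨n, Finset.mem_Iic.2 le_rfl⟩) (measurable_pi_apply _)

instance instIsMarkovKernelStepAt (P : TransitionMatrix) (n : ℕ) : IsMarkovKernel (P.stepAt n) :=
  inferInstanceAs (IsMarkovKernel (P.stepKernel.comap _ _))

/-- The stationary distribution of `P` is a probability measure, used as the initial law. -/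
instance instIsProbabilityMeasureInitial (P : TransitionMatrix) :
    IsProbabilityMeasure (weightMeasure P.stationaryDistribution) :=
  isProbabilityMeasure_weightMeasure P.2.2.choose_spec.1.1

end TransitionMatrix

/-- The stationary Markov measure `γ_P`: the law of the Markov chain with transition matrix `P`
started from the stationary distribution of `P`. -/
noncomputable def markovMeasure (P : TransitionMatrix) : Measure History :=
  Kernel.trajMeasure (X := fun _ : ℕ => Bool) (weightMeasure P.stationaryDistribution) P.stepAt

/-! ### Martin-Löf randomness -/

/-- A measure on histories is computable if the measures of cylinders are uniformly computable
reals, here through dyadic approximations `f s k / 2 ^ k` with error at most `2 ^ (-k)`. -/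
def IsComputableMeasure (μ : Measure History) : Prop :=
  ∃ f : List Bool → ℕ → ℕ, Computable₂ f ∧
    ∀ s k, |μ.real (cylinderOfString s) - (f s k : ℝ) / 2 ^ k| ≤ 1 / 2 ^ k

/-- The open set of histories that is generated by a set of strings. -/
def openSetOf (A : Set (List Bool)) : Set History := ⋃ s ∈ A, cylinderOfString s

/-- A Martin-Löf test for `μ`: a uniformly computably enumerable sequence of open sets, the `n`-th
of which has measure at most `2 ^ (-n)`. -/
def IsMartinLofTest (μ : Measure History) (U : ℕ → Set (List Bool)) : Prop :=
  REPred (fun q : ℕ × List Bool => q.2 ∈ U q.1) ∧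
    ∀ n, μ (openSetOf (U n)) ≤ (2 : ℝ≥0∞)⁻¹ ^ n

/-- The set of histories that are Martin-Löf random with respect to `μ`: those that pass every
Martin-Löf test for `μ`. As a proposition about the history, this is the `⋆`-law of `μ`. -/
def starLaw (μ : Measure History) : Set History :=
  {ω | ∀ U : ℕ → Set (List Bool), IsMartinLofTest μ U → ω ∉ ⋂ n, openSetOf (U n)}

/-! ### Cylinders over binary strings -/

/-! One fact carries the theorem: the restriction of a finite stationary measure ν to F =
`frequencyLaw P` is a multiple of γ_P (`HasStationaryLaw.restrict_frequencyLaw`). The set F is shift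
invariant, so the restriction is again stationary and the expected frequency of a word equals its
probability. On F the frequency of wba is at most P b a times that of wb, up to arbitrarily small
errors, so the same bound holds for probabilities. Both sides have the same sum over a, hence they
are equal, and uniqueness of the stationary distribution fixes the initial law. Neither an ergodic
theorem nor a representation theorem of de Finetti type is needed.

The star law M* of γ_P lies in F, because the law of large numbers along the times 2^k is a family
of Martin-Löf tests: Chebyshev's inequality gives a summable bound with an explicit rate
(`starLaw_subset_frequencyLaw`). Since γ_P(M*) = 1, it follows that ν(M* ∩ A) = ν(M*) γ_P(A) for
every stationary ν (`HasStationaryLaw.measure_starLaw_inter`). Exchangeable laws are stationary and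
the identity is linear in ν, so it holds for the prior in both cases. This is claim 1; claim 3 is
then the Markov property of γ_P. As β_{1/2} is itself a γ_P, the first half of claim 4 is claim 1
again.

For claim 2, let an exchangeable ν charge M*. Since F ignores finitely many tosses, γ_P inherits
from ν the invariance under swapping two coordinates, and a stationary two-state chain with γ_P(HHT)
= γ_P(HTH) is iid. The second half of claim 4 holds because a γ_P that charges the star law of γ_Q
equals γ_Q. -/

theorem mem_cylinderOfString {s : List Bool} {ω : History} :
    ω ∈ cylinderOfString s ↔ ∀ (i : ℕ) (h : i < s.length), ω i = s[i] :=
  ⟨fun h i hi => h ⟨i, hi⟩, fun h i => h i i.2⟩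

@[simp] theorem mem_cylinderOfString_nil (ω : History) : ω ∈ cylinderOfString [] := by
  simp [mem_cylinderOfString]

@[simp] theorem mem_cylinderOfString_cons {a : Bool} {s : List Bool} {ω : History} :
    ω ∈ cylinderOfString (a :: s) ↔ ω 0 = a ∧ timeShift 1 ω ∈ cylinderOfString s := by
  simp only [mem_cylinderOfString, timeShift]
  constructor
  · intro h
    refine ⟨h 0 (by simp), fun i hi => ?_⟩
    have := h (1 + i) (by simp; omega)
    simpa [Nat.add_comm 1 i] using this
  · rintro ⟨h0, h⟩ (_ | i) hi
    · simpa using! h0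
    · simpa [Nat.add_comm 1 i] using h i (by simpa using hi)

@[simp] theorem timeShift_zero (ω : History) : timeShift 0 ω = ω := by
  funext k; simp [timeShift]

theorem timeShift_timeShift (m n : ℕ) (ω : History) :
    timeShift m (timeShift n ω) = timeShift (m + n) ω := by
  funext k; simp [timeShift]; congr 1; omega

theorem mem_cylinderOfString_append {s t : List Bool} {ω : History} :
    ω ∈ cylinderOfString (s ++ t) ↔
      ω ∈ cylinderOfString s ∧ timeShift s.length ω ∈ cylinderOfString t := by
  induction s generalizing ω with
  | nil => simp
  | cons a s ih => simp [ih, timeShift_timeShift, and_assoc]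

theorem mem_cylinderOfString_concat {s : List Bool} {a : Bool} {ω : History} :
    ω ∈ cylinderOfString (s ++ [a]) ↔ ω ∈ cylinderOfString s ∧ ω s.length = a := by
  simp [mem_cylinderOfString_append, timeShift]

/-- The first `n` tosses of a history. -/
def historyPrefix (n : ℕ) (ω : History) : List Bool := (List.range n).map ω

@[simp] theorem length_historyPrefix (n : ℕ) (ω : History) : (historyPrefix n ω).length = n := by
  simp [historyPrefix]

theorem mem_cylinderOfString_historyPrefix {n : ℕ} {ω ω' : History} :
    ω' ∈ cylinderOfString (historyPrefix n ω) ↔ ∀ i < n, ω' i = ω i := by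
  simp [mem_cylinderOfString, historyPrefix]

theorem mem_cylinderOfString_historyPrefix_self (n : ℕ) (ω : History) :
    ω ∈ cylinderOfString (historyPrefix n ω) := by
  simp [mem_cylinderOfString_historyPrefix]

theorem cylinderOf_eq_cylinderOfString {n : ℕ} (x : Fin n → Bool) :
    cylinderOf x = cylinderOfString (List.ofFn x) := by
  ext ω
  simp only [mem_cylinderOfString, cylinderOf, Set.mem_ofPred_eq, List.getElem_ofFn]
  exact ⟨fun h i hi => h ⟨i, by simpa using hi⟩, fun h i => h i (by simp)⟩

theorem measurableSet_cylinderOfString (s : List Bool) : MeasurableSet (cylinderOfString s) := by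
  have : cylinderOfString s = ⋂ i : Fin s.length, (fun ω : History => ω i) ⁻¹' {s.get i} := by
    ext ω; simp [cylinderOfString, cylinderOf]
  rw [this]
  exact MeasurableSet.iInter fun i => (measurable_pi_apply _) (measurableSet_singleton _)

theorem measurable_timeShift (m : ℕ) : Measurable (timeShift m) :=
  measurable_pi_lambda _ fun _ => measurable_pi_apply _

/-- Two cylinders that share a history ω are nested; their intersection is the cylinder over the
longer of the two prefixes of ω. -/
theorem isPiSystem_range_cylinderOfString : IsPiSystem (Set.range cylinderOfString) := by
  rintro _ ⟨s, rfl⟩ _ ⟨t, rfl⟩ ⟨ω, hs, ht⟩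
  rw [mem_cylinderOfString] at hs ht
  refine ⟨historyPrefix (max s.length t.length) ω, ?_⟩
  ext ω'
  rw [mem_cylinderOfString_historyPrefix, Set.mem_inter_iff, mem_cylinderOfString,
    mem_cylinderOfString]
  constructor
  · exact fun h => ⟨fun i hi => (h i (by omega)).trans (hs i hi),
      fun i hi => (h i (by omega)).trans (ht i hi)⟩
  · rintro ⟨h1, h2⟩ i hi
    rcases lt_or_ge i s.length with h | h
    · rw [h1 i h, hs i h]
    · rw [h2 i (by omega), ht i (by omega)]

theorem generateFrom_range_cylinderOfString :
    (inferInstance : MeasurableSpace History) =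
      MeasurableSpace.generateFrom (Set.range cylinderOfString) := by
  apply le_antisymm
  · refine iSup_le fun i => ?_
    rintro _ ⟨B, -, rfl⟩
    have : (fun ω : History => ω i) ⁻¹' B =
        ⋃ s ∈ {s : List Bool | ∃ h : i < s.length, s[i] ∈ B}, cylinderOfString s := by
      ext ω
      simp only [Set.mem_preimage, Set.mem_ofPred_eq, Set.mem_iUnion, exists_prop]
      constructor
      · intro h
        exact ⟨historyPrefix (i + 1) ω, ⟨by simp, by simpa [historyPrefix] using h⟩,
          mem_cylinderOfString_historyPrefix_self _ _⟩
      · rintro ⟨s, ⟨h, hB⟩, hs⟩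
        rwa [mem_cylinderOfString.1 hs i h]
    rw [this]
    exact MeasurableSet.biUnion (Set.to_countable _) fun s _ =>
      MeasurableSpace.measurableSet_generateFrom ⟨s, rfl⟩
  · refine MeasurableSpace.generateFrom_le ?_
    rintro _ ⟨s, rfl⟩
    exact measurableSet_cylinderOfString s

theorem measure_ext_of_cylinderOfString {μ ν : Measure History} [IsFiniteMeasure μ]
    (h : ∀ s, μ (cylinderOfString s) = ν (cylinderOfString s)) : μ = ν := by
  refine ext_of_generate_finite _ generateFrom_range_cylinderOfString
    isPiSystem_range_cylinderOfString ?_ ?_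
  · rintro _ ⟨s, rfl⟩
    exact h s
  · have : (Set.univ : Set History) = cylinderOfString [] := by
      ext ω; simp
    rw [this, h]

theorem measure_cylinderOfString_eq_add_concat (ν : Measure History) (s : List Bool) :
    ν (cylinderOfString s) =
      ν (cylinderOfString (s ++ [true])) + ν (cylinderOfString (s ++ [false])) := by
  rw [← measure_union _ (measurableSet_cylinderOfString _)]
  · congr 1
    ext ω
    cases h : ω s.length <;> simp [mem_cylinderOfString_concat, h]
  · rw [Set.disjoint_left]
    intro ω h h'
    rw [mem_cylinderOfString_concat] at h h'
    simp [h.2] at h'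

theorem measure_timeShift_preimage_eq_add_cons (ν : Measure History) (s : List Bool) :
    ν (timeShift 1 ⁻¹' cylinderOfString s) =
      ν (cylinderOfString (true :: s)) + ν (cylinderOfString (false :: s)) := by
  rw [← measure_union _ (measurableSet_cylinderOfString _)]
  · congr 1
    ext ω
    cases h : ω 0 <;> simp [h]
  · rw [Set.disjoint_left]
    intro ω h h'
    rw [mem_cylinderOfString_cons] at h h'
    simp [h.1] at h'

theorem hasStationaryLaw_of_cylinderOfString {ν : Measure History} [IsFiniteMeasure ν]
    (h : ∀ s, ν (cylinderOfString (true :: s)) + ν (cylinderOfString (false :: s)) =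
      ν (cylinderOfString s)) : HasStationaryLaw ν := by
  refine ⟨measurable_timeShift 1, measure_ext_of_cylinderOfString fun s => ?_⟩
  rw [Measure.map_apply (measurable_timeShift 1) (measurableSet_cylinderOfString s),
    measure_timeShift_preimage_eq_add_cons, h]

/-! ### The stationary Markov measures on cylinders -/

namespace TransitionMatrix

theorem nonneg (P : TransitionMatrix) (a b : Bool) : 0 ≤ P.1 a b := P.2.1.1 a b

theorem row_sum (P : TransitionMatrix) (a : Bool) : P.1 a true + P.1 a false = 1 := by
  simpa using (Matrix.mem_rowStochastic_iff_sum.1 P.2.1).2 a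

theorem stationaryDistribution_spec (P : TransitionMatrix) :
    IsStationaryDistribution P.1 P.stationaryDistribution := P.2.2.choose_spec.1

theorem eq_stationaryDistribution (P : TransitionMatrix) {p : Bool → ℝ}
    (hp : IsStationaryDistribution P.1 p) : p = P.stationaryDistribution :=
  P.2.2.choose_spec.2 p hp

theorem stationaryDistribution_nonneg (P : TransitionMatrix) (b : Bool) :
    0 ≤ P.stationaryDistribution b := P.stationaryDistribution_spec.1.1 b

end TransitionMatrix

instance (P : TransitionMatrix) : IsProbabilityMeasure (markovMeasure P) :=
  inferInstanceAs (IsProbabilityMeasure (Kernel.trajMeasure _ _))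

theorem weightMeasure_singleton (p : Bool → ℝ) (b : Bool) :
    weightMeasure p {b} = ENNReal.ofReal (p b) := by
  cases b <;> simp [weightMeasure]

theorem markovMeasure_cylinderOfString_singleton (P : TransitionMatrix) (b : Bool) :
    markovMeasure P (cylinderOfString [b]) = ENNReal.ofReal (P.stationaryDistribution b) := by
  have h0 : (markovMeasure P).map (Preorder.frestrictLe (π := fun _ : ℕ => Bool) 0) =
      (weightMeasure P.stationaryDistribution).map
        (MeasurableEquiv.piUnique (fun _ : Finset.Iic 0 => Bool)).symm := by
    rw [markovMeasure, Kernel.trajMeasure, Measure.map_comp _ _ (by fun_prop),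
      Kernel.traj_map_frestrictLe, Kernel.partialTraj_self, Measure.id_comp]
  have h1 : cylinderOfString [b] = Preorder.frestrictLe (π := fun _ : ℕ => Bool) 0 ⁻¹'
      {x | x ⟨0, Finset.mem_Iic.2 le_rfl⟩ = b} := by
    ext ω; simp
  have hB : MeasurableSet {x : (i : Finset.Iic 0) → (fun _ : ℕ => Bool) i |
      x ⟨0, Finset.mem_Iic.2 le_rfl⟩ = b} := Set.Finite.measurableSet (Set.toFinite _)
  rw [h1, ← Measure.map_apply (by fun_prop) hB, h0,
    Measure.map_apply (by fun_prop) hB, ← weightMeasure_singleton]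
  rfl

/-- The joint law of the path up to time `s.length`, the time of `b`, and of the next state is a
composition product with the step kernel, whose value at `{a}` is constant on the cylinder. -/
theorem markovMeasure_cylinderOfString_concat_concat (P : TransitionMatrix) (s : List Bool)
    (b a : Bool) :
    markovMeasure P (cylinderOfString (s ++ [b] ++ [a])) =
      markovMeasure P (cylinderOfString (s ++ [b])) * ENNReal.ofReal (P.1 b a) := by
  have key := Kernel.map_frestrictLe_trajMeasure_compProd_eq_map_trajMeasure
    (X := fun _ : ℕ => Bool) (μ₀ := weightMeasure P.stationaryDistribution) (κ := P.stepAt)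
    (a := s.length)
  set B : Set ((i : Finset.Iic s.length) → (fun _ : ℕ => Bool) i) :=
    {x | ∀ (i : ℕ) (h : i < (s ++ [b]).length), x ⟨i, by simp at h ⊢; omega⟩ = (s ++ [b])[i]}
  have hB : MeasurableSet B := Set.Finite.measurableSet (Set.toFinite _)
  have := congrArg (fun μ => μ (B ×ˢ {a})) key
  simp only at this
  rw [Measure.compProd_apply_prod hB (measurableSet_singleton a), Measure.map_apply (by fun_prop)
    (hB.prod (measurableSet_singleton a))] at this
  have e1 : (fun x : History => (Preorder.frestrictLe (π := fun _ : ℕ => Bool) s.length x,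
      x (s.length + 1))) ⁻¹'
      (B ×ˢ {a}) = cylinderOfString (s ++ [b] ++ [a]) := by
    ext ω
    rw [mem_cylinderOfString_concat, mem_cylinderOfString]
    simp [B, Preorder.frestrictLe]
  have e2 : Preorder.frestrictLe (π := fun _ : ℕ => Bool) s.length ⁻¹' B =
      cylinderOfString (s ++ [b]) := by
    ext ω
    rw [mem_cylinderOfString]
    simp [B, Preorder.frestrictLe]
  have e3 : ∀ x ∈ B, P.stepAt s.length x {a} = ENNReal.ofReal (P.1 b a) := by
    intro x hx
    have hb : x ⟨s.length, Finset.mem_Iic.2 le_rfl⟩ = b := by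
      simpa using hx s.length (by simp)
    simp only [TransitionMatrix.stepAt, Kernel.comap_apply, TransitionMatrix.stepKernel]
    rw [hb]
    exact weightMeasure_singleton _ _
  rw [setLIntegral_congr_fun hB e3, setLIntegral_const, Measure.map_apply (by fun_prop) hB] at this
  erw [e1, e2] at this
  rw [mul_comm] at this
  exact this.symm

theorem HasStationaryLaw.measurePreserving_timeShift {ν : Measure History}
    (h : HasStationaryLaw ν) (n : ℕ) : MeasurePreserving (timeShift n) ν ν := by
  induction n with
  | zero =>
    convert! MeasurePreserving.id ν using 1
    funext ω
    simp
  | succ n ih =>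
    convert! ih.comp h using 1
    funext ω
    simp [timeShift_timeShift]

theorem IsStationaryDistribution.sum_eq {P : Matrix Bool Bool ℝ} {p : Bool → ℝ}
    (h : IsStationaryDistribution P p) (b : Bool) :
    p true * P true b + p false * P false b = p b := by
  simpa [Matrix.vecMul, dotProduct] using congrFun h.2 b

theorem IsStationaryDistribution.sum_eq_one {P : Matrix Bool Bool ℝ} {p : Bool → ℝ}
    (h : IsStationaryDistribution P p) : p true + p false = 1 := by
  simpa using h.1.2

/-- A measure whose cylinder probabilities factor along the transition matrix `P`, with initial
weights proportional to the stationary distribution, is a multiple of `γ_P`. -/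
theorem eq_smul_markovMeasure {ν : Measure History} [IsFiniteMeasure ν] (P : TransitionMatrix)
    (c : ℝ≥0∞)
    (h0 : ∀ b, ν (cylinderOfString [b]) = c * ENNReal.ofReal (P.stationaryDistribution b))
    (h1 : ∀ s b a, ν (cylinderOfString (s ++ [b] ++ [a])) =
      ν (cylinderOfString (s ++ [b])) * ENNReal.ofReal (P.1 b a)) :
    ν = c • markovMeasure P := by
  have key : ∀ s b, ν (cylinderOfString (s ++ [b])) =
      c * markovMeasure P (cylinderOfString (s ++ [b])) := by
    intro s
    induction s using List.reverseRecOn with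
    | nil =>
      intro b
      simpa only [List.nil_append, markovMeasure_cylinderOfString_singleton] using h0 b
    | append_singleton s a ih =>
      intro b
      rw [h1, markovMeasure_cylinderOfString_concat_concat, ih, mul_assoc]
  refine measure_ext_of_cylinderOfString fun s => ?_
  rw [Measure.smul_apply, smul_eq_mul]
  rcases s.eq_nil_or_concat with rfl | ⟨s, b, rfl⟩
  · rw [measure_cylinderOfString_eq_add_concat ν, measure_cylinderOfString_eq_add_concat
      (markovMeasure P), key, key, mul_add]
  · rw [List.concat_eq_append, key]

/-- Induction from the right end of the word: for one letter this is the stationarity equation, and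
each further letter multiplies both sides by the same transition probability. -/
theorem hasStationaryLaw_markovMeasure (P : TransitionMatrix) :
    HasStationaryLaw (markovMeasure P) := by
  have key : ∀ s b, markovMeasure P (cylinderOfString (true :: (s ++ [b]))) +
      markovMeasure P (cylinderOfString (false :: (s ++ [b]))) =
        markovMeasure P (cylinderOfString (s ++ [b])) := by
    intro s
    induction s using List.reverseRecOn with
    | nil =>
      intro b
      have h (a : Bool) : markovMeasure P (cylinderOfString (a :: ([] ++ [b]))) =
          ENNReal.ofReal (P.stationaryDistribution a * P.1 a b) := by
        rw [ENNReal.ofReal_mul (P.stationaryDistribution_nonneg a),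
          ← markovMeasure_cylinderOfString_singleton]
        exact markovMeasure_cylinderOfString_concat_concat P [] a b
      rw [h, h, List.nil_append, markovMeasure_cylinderOfString_singleton, ← ENNReal.ofReal_add
        (mul_nonneg (P.stationaryDistribution_nonneg _) (P.nonneg _ _))
        (mul_nonneg (P.stationaryDistribution_nonneg _) (P.nonneg _ _)),
        P.stationaryDistribution_spec.sum_eq]
    | append_singleton s a ih =>
      intro b
      have h (c : Bool) := markovMeasure_cylinderOfString_concat_concat P (c :: s) a b
      simp only [List.cons_append] at h
      rw [h, h, markovMeasure_cylinderOfString_concat_concat, ← add_mul, ih]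
  refine hasStationaryLaw_of_cylinderOfString fun s => ?_
  rcases s.eq_nil_or_concat with rfl | ⟨s, b, rfl⟩
  · exact (measure_cylinderOfString_eq_add_concat _ []).symm
  · rw [List.concat_eq_append, key]

/-- By stationarity the state at every time has the initial law. The bound makes every word null
that ends in a state of stationary weight zero. -/
theorem markovMeasure_cylinderOfString_concat_le (P : TransitionMatrix) (s : List Bool)
    (b : Bool) : markovMeasure P (cylinderOfString (s ++ [b])) ≤
      ENNReal.ofReal (P.stationaryDistribution b) := by
  have := ((hasStationaryLaw_markovMeasure
    P).measurePreserving_timeShift s.length).measure_preimage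
    (measurableSet_cylinderOfString [b]).nullMeasurableSet
  rw [← markovMeasure_cylinderOfString_singleton, ← this]
  exact measure_mono fun ω h => (mem_cylinderOfString_append.1 h).2

/-! ### The iid measures -/

instance (θ : I) : IsProbabilityMeasure (iidMeasure θ) :=
  inferInstanceAs (IsProbabilityMeasure (Measure.infinitePi _))

theorem iidMeasure_setOf_perm (θ : I) {n : ℕ} (x : Fin n → Bool) (π : Equiv.Perm (Fin n)) :
    iidMeasure θ {ω | ∀ i : Fin n, ω (π i) = x i} =
      ∏ i, bernoulliMeasure true false θ {x i} := by
  have : {ω : History | ∀ i : Fin n, ω (π i) = x i} =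
      Set.pi (Finset.range n)
        -- The value `∅` is never used, as the product runs over `j < n` only.
        (fun j => if h : j < n then {x (π.symm ⟨j, h⟩)} else (∅ : Set Bool)) := by
    ext ω
    simp only [Set.mem_ofPred_eq, Set.mem_pi, Finset.coe_range, Set.mem_Iio]
    constructor
    · intro h j hj
      simpa [hj] using h (π.symm ⟨j, hj⟩)
    · intro h i
      simpa using h (π i) (π i).2
  rw [this, iidMeasure, Measure.infinitePi_pi _ (fun i _ => Set.Finite.measurableSet
    (Set.toFinite _)), Finset.prod_range]
  simp only [Fin.is_lt, dite_true, Fin.eta]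
  exact Equiv.prod_comp π.symm fun i => bernoulliMeasure true false θ {x i}

theorem isExchangeable_iidMeasure (θ : I) : IsExchangeable (iidMeasure θ) := by
  intro n x π
  rw [iidMeasure_setOf_perm θ x π]
  exact iidMeasure_setOf_perm θ x 1

theorem iidMeasure_cylinderOfString_concat (θ : I) (s : List Bool) (a : Bool) :
    iidMeasure θ (cylinderOfString (s ++ [a])) =
      iidMeasure θ (cylinderOfString s) * bernoulliMeasure true false θ {a} := by
  have h (s : List Bool) : iidMeasure θ (cylinderOfString s) =
      (s.map fun b => bernoulliMeasure true false θ {b}).prod := by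
    have := iidMeasure_setOf_perm θ s.get 1
    rw [← List.prod_ofFn] at this
    have e : (List.ofFn fun i => bernoulliMeasure true false θ {s.get i}) =
        s.map fun b => bernoulliMeasure true false θ {b} := by
      conv_rhs => rw [← List.ofFn_get s, List.map_ofFn]
      rfl
    rw [e] at this
    exact this
  rw [h, h]
  simp

/-- The weights of a toss with probability `θ` of heads. -/
def tossWeight (θ : ℝ) (b : Bool) : ℝ := if b then θ else 1 - θ

theorem bernoulliMeasure_singleton (θ : I) (b : Bool) :
    bernoulliMeasure true false θ {b} = ENNReal.ofReal (tossWeight θ b) := by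
  rw [← ofReal_measureReal, bernoulliMeasure_real_apply _ (measurableSet_singleton b)]
  cases b <;> simp [tossWeight]

/-- A cyclic permutation moves the first letter to the end, so prepending a letter has the same
probability as appending it, and for appended letters the sum is plain additivity. -/
theorem IsExchangeable.hasStationaryLaw {ν : Measure History} [IsFiniteMeasure ν]
    (h : IsExchangeable ν) : HasStationaryLaw ν := by
  refine hasStationaryLaw_of_cylinderOfString fun s => ?_
  have key (b : Bool) : ν (cylinderOfString (b :: s)) = ν (cylinderOfString (s ++ [b])) := by
    have e1 : cylinderOfString (b :: s) = {ω | ∀ i : Fin (s.length + 1),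
        ω (finRotate _ i) = Fin.snoc (α := fun _ => Bool) s.get b i} := by
      ext ω
      rw [mem_cylinderOfString_cons, mem_cylinderOfString]
      simp only [Fin.forall_fin_succ', Set.mem_ofPred_eq, timeShift, Fin.snoc_castSucc, Fin.snoc_last, finRotate_last, Fin.val_zero]
      rw [and_comm]
      refine and_congr_left fun _ => ?_
      have (i : Fin s.length) : (finRotate (s.length + 1) i.castSucc : ℕ) = 1 + i := by
        rw [coe_finRotate_of_ne_last (Fin.castSucc_lt_last i).ne, Fin.val_castSucc, add_comm]
      simp only [this]
      exact ⟨fun h i => h i i.2, fun h i hi => h ⟨i, hi⟩⟩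
    have e2 : cylinderOfString (s ++ [b]) = {ω | ∀ i : Fin (s.length + 1),
        ω i = Fin.snoc (α := fun _ => Bool) s.get b i} := by
      ext ω
      rw [mem_cylinderOfString_concat, mem_cylinderOfString]
      simp only [Fin.forall_fin_succ', Set.mem_ofPred_eq, Fin.snoc_castSucc, Fin.snoc_last, Fin.val_castSucc, Fin.val_last]
      exact and_congr_left fun _ => ⟨fun h i => h i i.2, fun h i hi => h ⟨i, hi⟩⟩
    rw [e1, e2]
    exact (h _ _ _).symm
  rw [key, key, ← measure_cylinderOfString_eq_add_concat]

/-- If the steps of the chain do not depend on the current state, at the states that it visits,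
then `γ_P` is an iid measure. -/
theorem markovMeasure_eq_iidMeasure (P : TransitionMatrix) (θ : I)
    (h : ∀ b a, P.stationaryDistribution b * P.1 b a =
      P.stationaryDistribution b * tossWeight θ a) :
    markovMeasure P = iidMeasure θ := by
  have key : ∀ s a, markovMeasure P (cylinderOfString (s ++ [a])) =
      markovMeasure P (cylinderOfString s) * ENNReal.ofReal (tossWeight θ a) := by
    intro s a
    rcases s.eq_nil_or_concat with rfl | ⟨s, b, rfl⟩
    · have e : P.stationaryDistribution a = tossWeight θ a := by
        rw [← P.stationaryDistribution_spec.sum_eq, h, h, ← add_mul,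
          P.stationaryDistribution_spec.sum_eq_one, one_mul]
      have u : cylinderOfString [] = Set.univ := by ext; simp
      rw [List.nil_append, markovMeasure_cylinderOfString_singleton, e, u, measure_univ, one_mul]
    · rw [List.concat_eq_append, markovMeasure_cylinderOfString_concat_concat]
      -- The row of a state of weight zero is arbitrary, but words ending in that state are null.
      rcases eq_or_ne (P.stationaryDistribution b) 0 with h0 | h0
      · have := markovMeasure_cylinderOfString_concat_le P s b
        rw [h0, ENNReal.ofReal_zero, nonpos_iff_eq_zero] at this
        rw [this, zero_mul, zero_mul]
      · rw [mul_left_cancel₀ h0 (h b a)]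
  refine measure_ext_of_cylinderOfString fun s => ?_
  induction s using List.reverseRecOn with
  | nil =>
    have u : cylinderOfString [] = Set.univ := by ext; simp
    rw [u, measure_univ, measure_univ]
  | append_singleton s a ih =>
    rw [key, ih, iidMeasure_cylinderOfString_concat, bernoulliMeasure_singleton]

/-- This makes the star law of the fair coin an instance of the star law of a stationary Markov
measure. -/
theorem exists_markovMeasure_eq_iidMeasure_halfProb :
    ∃ P : TransitionMatrix, markovMeasure P = iidMeasure halfProb := by
  have hs : (Matrix.of fun _ _ => 1 / 2 : Matrix Bool Bool ℝ) ∈ Matrix.rowStochastic ℝ Bool := by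
    rw [Matrix.mem_rowStochastic_iff_sum]
    exact ⟨fun _ _ => by norm_num, fun _ => by norm_num⟩
  refine ⟨⟨Matrix.of fun _ _ => 1 / 2, hs, fun _ => 1 / 2, ⟨⟨fun _ => by positivity, by norm_num⟩, ?_⟩,
    ?_⟩, markovMeasure_eq_iidMeasure _ _ fun b a => ?_⟩
  · funext b
    simp [Matrix.vecMul, dotProduct]
  · intro p hp
    funext b
    have h1 := hp.sum_eq b
    have h2 := hp.sum_eq_one
    simp only [Matrix.of_apply] at h1
    linarith
  · congr 1
    cases a <;> norm_num [tossWeight, halfProb]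

/-! ### Occurrences of words and Chebyshev's inequality -/

/-- The number of occurrences of the word `w` at the positions `0, …, n - 1` of a history. -/
noncomputable def occurrences (w : List Bool) (n : ℕ) (ω : History) : ℕ :=
  ∑ i ∈ Finset.range n, (cylinderOfString w).indicator 1 (timeShift i ω)

theorem occurrences_succ (w : List Bool) (n : ℕ) (ω : History) :
    occurrences w (n + 1) ω =
      occurrences w n ω + (cylinderOfString w).indicator 1 (timeShift n ω) :=
  Finset.sum_range_succ _ _

theorem measurable_occurrences (w : List Bool) (n : ℕ) : Measurable (occurrences w n) :=
  Finset.measurable_fun_sum _ fun i _ =>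
    (measurable_one.indicator (measurableSet_cylinderOfString w)).comp (measurable_timeShift i)

theorem occurrences_le (w : List Bool) (n : ℕ) (ω : History) : occurrences w n ω ≤ n := by
  refine (Finset.sum_le_card_nsmul _ _ 1 fun i _ => ?_).trans (by simp)
  by_cases h : timeShift i ω ∈ cylinderOfString w <;> simp [h]

theorem timeShift_mem_cylinderOfString_congr {w : List Bool} {n : ℕ} {ω ω' : History}
    (h : ∀ i < n + w.length, ω i = ω' i) :
    timeShift n ω ∈ cylinderOfString w ↔ timeShift n ω' ∈ cylinderOfString w := by
  simp only [mem_cylinderOfString, timeShift]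
  exact forall₂_congr fun i hi => by rw [h _ (by omega)]

/-- The last window starts at `n - 1`, so one letter fewer than `n + w.length` is read. Because of
this, the deviations before time `n` depend only on the past allowed in
`integral_mul_stepDeviation`. -/
theorem occurrences_congr {w : List Bool} {n : ℕ} {ω ω' : History}
    (h : ∀ i, i + 1 < n + w.length → ω i = ω' i) : occurrences w n ω = occurrences w n ω' := by
  refine Finset.sum_congr rfl fun i hi => ?_
  rw [Finset.mem_range] at hi
  have := timeShift_mem_cylinderOfString_congr (w := w) (n := i) (ω := ω) (ω' := ω')
    fun j hj => h j (by omega)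
  by_cases h' : timeShift i ω ∈ cylinderOfString w
  · simp [h', this.1 h']
  · simp [h', mt this.2 h']

/-- The deviation of the step after the word `w ++ [b]` from its conditional expectation, if that
word occurs at the start of the history. -/
noncomputable def stepDeviation (P : TransitionMatrix) (w : List Bool) (b a : Bool)
    (ω : History) : ℝ :=
  (cylinderOfString (w ++ [b] ++ [a])).indicator 1 ω -
    P.1 b a * (cylinderOfString (w ++ [b])).indicator 1 ω

theorem TransitionMatrix.le_one (P : TransitionMatrix) (a b : Bool) : P.1 a b ≤ 1 := by
  have := P.row_sum a
  have h1 := P.nonneg a true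
  have h2 := P.nonneg a false
  cases b <;> linarith

theorem abs_stepDeviation_le (P : TransitionMatrix) (w : List Bool) (b a : Bool) (ω : History) :
    |stepDeviation P w b a ω| ≤ 1 := by
  have h0 := P.nonneg b a
  have h1 := P.le_one b a
  rw [stepDeviation, abs_le]
  by_cases h : ω ∈ cylinderOfString (w ++ [b])
  · by_cases h' : ω ∈ cylinderOfString (w ++ [b] ++ [a])
    · simp only [h, h', Set.indicator_of_mem, Pi.one_apply]
      constructor <;> linarith
    · simp only [h, h', Set.indicator_of_mem, Pi.one_apply, not_false_iff,
        Set.indicator_of_notMem]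
      constructor <;> linarith
  · have h' : ω ∉ cylinderOfString (w ++ [b] ++ [a]) :=
      fun h' => h (mem_cylinderOfString_concat.1 h').1
    simp only [h, h', not_false_iff, Set.indicator_of_notMem]
    constructor <;> linarith

theorem measurable_stepDeviation (P : TransitionMatrix) (w : List Bool) (b a : Bool) :
    Measurable (stepDeviation P w b a) :=
  (measurable_one.indicator (measurableSet_cylinderOfString _)).sub
    ((measurable_one.indicator (measurableSet_cylinderOfString _)).const_mul _)

theorem markovMeasure_real_cylinderOfString_concat_concat (P : TransitionMatrix) (s : List Bool)
    (b a : Bool) :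
    (markovMeasure P).real (cylinderOfString (s ++ [b] ++ [a])) =
      P.1 b a * (markovMeasure P).real (cylinderOfString (s ++ [b])) := by
  rw [measureReal_def, markovMeasure_cylinderOfString_concat_concat, ENNReal.toReal_mul,
    ENNReal.toReal_ofReal (P.nonneg b a), mul_comm, measureReal_def]

theorem integral_stepDeviation (P : TransitionMatrix) (w : List Bool) (b a : Bool) :
    ∫ ω, stepDeviation P w b a ω ∂markovMeasure P = 0 := by
  have hi (s : List Bool) : Integrable ((cylinderOfString s).indicator (1 : History → ℝ))
      (markovMeasure P) :=
    (integrable_const (1 : ℝ)).indicator (measurableSet_cylinderOfString s)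
  simp only [stepDeviation]
  rw [integral_sub (hi _) ((hi _).const_mul _), integral_const_mul,
    integral_indicator_one (measurableSet_cylinderOfString _),
    integral_indicator_one (measurableSet_cylinderOfString _),
    markovMeasure_real_cylinderOfString_concat_concat, sub_self]

/-- Once the prefix is fixed, a shifted deviation is an unshifted one for a longer word, whose mean
is known to vanish. -/
theorem stepDeviation_append (P : TransitionMatrix) (t w : List Bool) (b a : Bool)
    (ω : History) (h : ω ∈ cylinderOfString t) :
    stepDeviation P (t ++ w) b a ω = stepDeviation P w b a (timeShift t.length ω) := by
  have (s : List Bool) : (cylinderOfString (t ++ s)).indicator (1 : History → ℝ) ω =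
      (cylinderOfString s).indicator 1 (timeShift t.length ω) := by
    have := mem_cylinderOfString_append (s := t) (t := s) (ω := ω)
    by_cases h' : timeShift t.length ω ∈ cylinderOfString s
    · simp [h', this.2 ⟨h, h'⟩]
    · simp [h', mt this.1 (fun h'' => h' h''.2)]
  simp only [stepDeviation, List.append_assoc] at *
  rw [this, this]

theorem stepDeviation_eq_zero (P : TransitionMatrix) (w : List Bool) (b a : Bool)
    (ω : History) (h : ω ∉ cylinderOfString (w ++ [b])) : stepDeviation P w b a ω = 0 := by
  have h' : ω ∉ cylinderOfString (w ++ [b] ++ [a]) :=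
    fun h' => h (mem_cylinderOfString_concat.1 h').1
  simp only [stepDeviation, h, h', not_false_iff, Set.indicator_of_notMem, mul_zero, sub_zero]

/-- The deviation at time `n` is orthogonal to the functions of the past. -/
theorem integral_mul_stepDeviation (P : TransitionMatrix) (w : List Bool) (b a : Bool) (n : ℕ)
    (f : History → ℝ)
    (hf : ∀ ω ω', (∀ i < n + (w.length + 1), ω i = ω' i) → f ω = f ω') :
    ∫ ω, f ω * stepDeviation P w b a (timeShift n ω) ∂markovMeasure P = 0 := by
  -- Split by the first `n` letters: only the summand of the true prefix survives. Where its
  -- deviation is nonzero, `f` is determined by the prefix followed by `w ++ [b]`, so the default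
  -- `false` of `getD` has no influence.
  have key (ω : History) : f ω * stepDeviation P w b a (timeShift n ω) =
      ∑ x : Fin n → Bool, f (fun i => (List.ofFn x ++ (w ++ [b])).getD i false) *
        stepDeviation P (List.ofFn x ++ w) b a ω := by
    rw [Finset.sum_eq_single (fun i : Fin n => ω i)]
    · set t := List.ofFn fun i : Fin n => ω i with ht
      have hlen : t.length = n := by simp [ht]
      have hω : ω ∈ cylinderOfString t := by
        rw [mem_cylinderOfString]
        simp [ht]
      rw [stepDeviation_append P t w b a ω hω, hlen]
      by_cases h : timeShift n ω ∈ cylinderOfString (w ++ [b])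
      · congr 1
        refine hf _ _ fun i hi => ?_
        have h2 : ω ∈ cylinderOfString (t ++ (w ++ [b])) :=
          mem_cylinderOfString_append.2 ⟨hω, by rwa [hlen]⟩
        rw [mem_cylinderOfString.1 h2 i (by simp [hlen]; omega), List.getD_eq_getElem]
      · rw [stepDeviation_eq_zero P w b a _ h, mul_zero, mul_zero]
    · intro x _ hx
      rw [stepDeviation_eq_zero, mul_zero]
      intro h
      refine hx (funext fun i => ?_)
      rw [List.append_assoc, mem_cylinderOfString_append] at h
      simpa using (mem_cylinderOfString.1 h.1 i (by simp)).symm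
    · simp
  simp only [key]
  rw [integral_finsetSum]
  · simp [integral_const_mul, integral_stepDeviation]
  · intro x _
    exact (Integrable.of_bound (measurable_stepDeviation P _ b a).aestronglyMeasurable 1
      (ae_of_all _ fun ω => abs_stepDeviation_le P _ b a ω)).const_mul _

theorem sum_stepDeviation (P : TransitionMatrix) (w : List Bool) (b a : Bool) (n : ℕ)
    (ω : History) : ∑ i ∈ Finset.range n, stepDeviation P w b a (timeShift i ω) =
      occurrences (w ++ [b] ++ [a]) n ω - P.1 b a * occurrences (w ++ [b]) n ω := by
  have h (s : List Bool) (η : History) : (((cylinderOfString s).indicator 1 η : ℕ) : ℝ) =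
      (cylinderOfString s).indicator 1 η := by
    by_cases h : η ∈ cylinderOfString s <;> simp [h]
  simp only [stepDeviation, occurrences, Nat.cast_sum, h, Finset.sum_sub_distrib, Finset.mul_sum]

/-- The deviations are martingale differences: the cross terms vanish, and each square adds at most
1. -/
theorem integral_sum_stepDeviation_sq_le (P : TransitionMatrix) (w : List Bool) (b a : Bool)
    (n : ℕ) : ∫ ω, (∑ i ∈ Finset.range n, stepDeviation P w b a (timeShift i ω)) ^ 2
      ∂markovMeasure P ≤ n := by
  have hm (n : ℕ) : Measurable fun ω => stepDeviation P w b a (timeShift n ω) :=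
    (measurable_stepDeviation P w b a).comp (measurable_timeShift n)
  have hD (n : ℕ) : Measurable fun ω =>
      ∑ i ∈ Finset.range n, stepDeviation P w b a (timeShift i ω) :=
    Finset.measurable_fun_sum _ fun i _ => hm i
  have hb (n : ℕ) (ω : History) :
      |∑ i ∈ Finset.range n, stepDeviation P w b a (timeShift i ω)| ≤ n := by
    refine (Finset.abs_sum_le_sum_abs _ _).trans
      ((Finset.sum_le_card_nsmul _ _ 1 fun i _ => abs_stepDeviation_le P w b a _).trans ?_)
    simp
  induction n with
  | zero => simp
  | succ n ih =>
    have i1 : Integrable (fun ω => (∑ i ∈ Finset.range n,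
        stepDeviation P w b a (timeShift i ω)) ^ 2) (markovMeasure P) := by
      refine Integrable.of_bound ((hD n).pow_const 2).aestronglyMeasurable ((n : ℝ) ^ 2)
        (ae_of_all _ fun ω => ?_)
      rw [Real.norm_eq_abs, abs_pow]
      exact pow_le_pow_left₀ (abs_nonneg _) (hb n ω) 2
    have i2 : Integrable (fun ω => (∑ i ∈ Finset.range n,
        stepDeviation P w b a (timeShift i ω)) * stepDeviation P w b a (timeShift n ω))
        (markovMeasure P) := by
      refine Integrable.of_bound ((hD n).mul (hm n)).aestronglyMeasurable (n * 1)
        (ae_of_all _ fun ω => ?_)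
      rw [Real.norm_eq_abs, abs_mul]
      exact mul_le_mul (hb n ω) (abs_stepDeviation_le P w b a _) (abs_nonneg _) n.cast_nonneg
    have i3 : Integrable (fun ω => (stepDeviation P w b a (timeShift n ω)) ^ 2)
        (markovMeasure P) := by
      refine Integrable.of_bound ((hm n).pow_const 2).aestronglyMeasurable (1 ^ 2)
        (ae_of_all _ fun ω => ?_)
      rw [Real.norm_eq_abs, abs_pow]
      exact pow_le_pow_left₀ (abs_nonneg _) (abs_stepDeviation_le P w b a _) 2
    have e0 : ∫ ω, (∑ i ∈ Finset.range n, stepDeviation P w b a (timeShift i ω)) *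
        stepDeviation P w b a (timeShift n ω) ∂markovMeasure P = 0 := by
      refine integral_mul_stepDeviation P w b a n _ fun ω ω' h => ?_
      rw [sum_stepDeviation, sum_stepDeviation,
        occurrences_congr fun i hi => h i (by simp at hi; omega),
        occurrences_congr fun i hi => h i (by simp at hi; omega)]
    have e1 : ∫ ω, (stepDeviation P w b a (timeShift n ω)) ^ 2 ∂markovMeasure P ≤ 1 := by
      refine (integral_mono i3 (integrable_const 1) fun ω => ?_).trans (by simp)
      rw [← sq_abs]
      exact pow_le_one₀ (abs_nonneg _) (abs_stepDeviation_le P w b a _)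
    have e2 (x y : ℝ) : (x + y) ^ 2 = x ^ 2 + 2 * (x * y) + y ^ 2 := by ring
    simp only [Finset.sum_range_succ, e2]
    have i4 : Integrable (fun ω => (∑ i ∈ Finset.range n,
        stepDeviation P w b a (timeShift i ω)) ^ 2 + 2 * ((∑ i ∈ Finset.range n,
        stepDeviation P w b a (timeShift i ω)) * stepDeviation P w b a (timeShift n ω)))
        (markovMeasure P) := i1.add (i2.const_mul 2)
    rw [integral_add i4 i3, integral_add i1 (i2.const_mul 2),
      integral_const_mul, e0]
    push_cast
    linarith

/-- Chebyshev: on this event `d` times the sum of deviations is at least `2 ^ k`, while its second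
moment is at most `d ^ 2 * 2 ^ k`. The bound is summable along the times `2 ^ k`. Replacing the
transition probability by natural numbers `c`, `d` keeps the event decidable from finitely many
tosses. -/
theorem markovMeasure_setOf_occurrences_lt_le (P : TransitionMatrix) (w : List Bool) (b a : Bool)
    {c d : ℕ} (hcd : P.1 b a * d ≤ c) (k : ℕ) :
    markovMeasure P {ω | c * occurrences (w ++ [b]) (2 ^ k) ω + 2 ^ k <
      d * occurrences (w ++ [b] ++ [a]) (2 ^ k) ω} ≤ d ^ 2 * (2 : ℝ≥0∞)⁻¹ ^ k := by
  set D : History → ℝ :=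
    fun ω => ∑ i ∈ Finset.range (2 ^ k), stepDeviation P w b a (timeShift i ω) with hD
  have hsub : {ω | c * occurrences (w ++ [b]) (2 ^ k) ω + 2 ^ k <
      d * occurrences (w ++ [b] ++ [a]) (2 ^ k) ω} ⊆
      {ω | ((2 : ℝ) ^ k) ^ 2 ≤ (d * D ω) ^ 2} := by
    intro ω hω
    rw [Set.mem_ofPred_eq] at hω ⊢
    have h1 : (c * occurrences (w ++ [b]) (2 ^ k) ω + 2 ^ k : ℝ) <
      d * occurrences (w ++ [b] ++ [a]) (2 ^ k) ω := by exact_mod_cast hω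
    have h2 := mul_le_mul_of_nonneg_right hcd
      (Nat.cast_nonneg (α := ℝ) (occurrences (w ++ [b]) (2 ^ k) ω))
    refine pow_le_pow_left₀ (by positivity) ?_ 2
    rw [hD]
    simp only
    rw [sum_stepDeviation]
    nlinarith
  have hmD : Measurable D := Finset.measurable_fun_sum _ fun i _ =>
    (measurable_stepDeviation P w b a).comp (measurable_timeShift i)
  have hint : Integrable (fun ω => (d * D ω) ^ 2) (markovMeasure P) := by
    refine Integrable.of_bound ((hmD.const_mul _).pow_const 2).aestronglyMeasurable
      ((d * 2 ^ k : ℝ) ^ 2) (ae_of_all _ fun ω => ?_)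
    rw [Real.norm_eq_abs, abs_pow, abs_mul, Nat.abs_cast]
    refine pow_le_pow_left₀ (by positivity) (mul_le_mul_of_nonneg_left ?_ d.cast_nonneg) 2
    refine (Finset.abs_sum_le_sum_abs _ _).trans
      ((Finset.sum_le_card_nsmul _ _ 1 fun i _ => abs_stepDeviation_le P w b a _).trans ?_)
    simp
  have cheb := mul_meas_ge_le_integral_of_nonneg (μ := markovMeasure P)
    (ae_of_all _ fun ω => sq_nonneg (d * D ω)) hint (((2 : ℝ) ^ k) ^ 2)
  have hle : ∫ ω, (d * D ω) ^ 2 ∂markovMeasure P ≤ d ^ 2 * 2 ^ k := by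
    simp only [mul_pow]
    rw [integral_const_mul]
    refine mul_le_mul_of_nonneg_left ?_ (by positivity)
    exact_mod_cast integral_sum_stepDeviation_sq_le P w b a (2 ^ k)
  have hreal : (markovMeasure P).real {ω | ((2 : ℝ) ^ k) ^ 2 ≤ (d * D ω) ^ 2} ≤
      d ^ 2 * 2⁻¹ ^ k := by
    have h2 : (0 : ℝ) < 2 ^ k := by positivity
    rw [inv_pow, ← div_eq_mul_inv, le_div_iff₀ h2]
    refine le_of_mul_le_mul_left ?_ h2
    calc _ = ((2 : ℝ) ^ k) ^ 2 * (markovMeasure P).real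
          {ω | ((2 : ℝ) ^ k) ^ 2 ≤ (d * D ω) ^ 2} := by ring
      _ ≤ d ^ 2 * 2 ^ k := cheb.trans hle
      _ = _ := by ring
  refine (measure_mono hsub).trans ?_
  rw [← ofReal_measureReal]
  refine (ENNReal.ofReal_le_ofReal hreal).trans (le_of_eq ?_)
  rw [ENNReal.ofReal_mul (by positivity), ENNReal.ofReal_pow (by positivity),
    ENNReal.ofReal_pow (by positivity), ENNReal.ofReal_natCast,
    ENNReal.ofReal_inv_of_pos (by norm_num), ENNReal.ofReal_ofNat]

/-! ### The law of large numbers as a family of Martin-Löf tests -/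

/-- The number of occurrences of the word `w` at the positions `0, …, n - 1` of a string. -/
def stringOccurrences (w : List Bool) (n : ℕ) (s : List Bool) : ℕ :=
  ((List.range n).filter fun i => (s.drop i).take w.length = w).length

theorem stringOccurrences_eq {w s : List Bool} {n : ℕ} {ω : History}
    (hω : ω ∈ cylinderOfString s) (hn : n + w.length ≤ s.length) :
    stringOccurrences w n s = occurrences w n ω := by
  have h (i : ℕ) (hi : i < n) :
      (s.drop i).take w.length = w ↔ timeShift i ω ∈ cylinderOfString w := by
    simp only [mem_cylinderOfString] at hω ⊢
    constructor
    · intro h j hj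
      have h' : j < ((s.drop i).take w.length).length := by rwa [h]
      rw [timeShift, hω _ (by omega)]
      conv_rhs => rw [← List.getElem_of_eq h h']
      simp
    · intro h
      refine List.ext_getElem (by simp; omega) fun j h1 h2 => ?_
      rw [← h j h2, timeShift, hω _ (by omega)]
      simp
  have e (p : ℕ → Bool) : ((List.range n).filter p).length =
      ((Finset.range n).filter fun i => p i).card := by
    simp [Finset.card, Finset.filter, Finset.range, Multiset.range]
  rw [stringOccurrences, e, Finset.card_filter, occurrences]
  refine Finset.sum_congr rfl fun i hi => ?_
  have := h i (Finset.mem_range.1 hi)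
  by_cases h' : timeShift i ω ∈ cylinderOfString w
  · simp [this.2 h', h']
  · simp [mt this.1 h', h']

theorem primrec_two_pow : Primrec fun k : ℕ => 2 ^ k :=
  (Primrec₂.unpaired'.1 Nat.Primrec.pow).comp (Primrec.const 2) Primrec.id

theorem primrec_stringOccurrences (w : List Bool) : Primrec₂ (stringOccurrences w) := by
  have hR : PrimrecRel fun (i : ℕ) (s : List Bool) => (s.drop i).take w.length = w :=
    Primrec.eq.comp (Primrec.list_take.comp (Primrec.const _)
      (Primrec.list_drop.comp Primrec.fst Primrec.snd)) (Primrec.const w)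
  exact Primrec.list_length.comp
    (hR.listFilter.comp (Primrec.list_range.comp Primrec.fst) Primrec.snd)

/-- The Martin-Löf test for the law of large numbers: after some time `2 ^ (n + K)`, at some time
`2 ^ k`, the word `w ++ [b]` is followed too often by `a`. -/
def frequencyTest (w : List Bool) (b a : Bool) (c d K n : ℕ) : Set (List Bool) :=
  {s | ∃ k < s.length, n + K ≤ k ∧ s.length = 2 ^ k + (w.length + 2) ∧
    c * stringOccurrences (w ++ [b]) (2 ^ k) s + 2 ^ k <
      d * stringOccurrences (w ++ [b] ++ [a]) (2 ^ k) s}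

/-- The quantifier over `k` is bounded by the length of the string, so membership is primitive
recursive. The bound excludes nothing, because the length exceeds `2 ^ k > k`. -/
theorem rePred_frequencyTest (w : List Bool) (b a : Bool) (c d K : ℕ) :
    REPred fun q : ℕ × List Bool => q.2 ∈ frequencyTest w b a c d K q.1 := by
  have hR : PrimrecRel fun (k : ℕ) (q : ℕ × List Bool) => q.1 + K ≤ k ∧
      q.2.length = 2 ^ k + (w.length + 2) ∧
      c * stringOccurrences (w ++ [b]) (2 ^ k) q.2 + 2 ^ k <
        d * stringOccurrences (w ++ [b] ++ [a]) (2 ^ k) q.2 := by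
    have hs : Primrec fun p : ℕ × ℕ × List Bool => p.2.2 := Primrec.snd.comp Primrec.snd
    have hp : Primrec fun p : ℕ × ℕ × List Bool => 2 ^ p.1 := primrec_two_pow.comp Primrec.fst
    have ho (w : List Bool) : Primrec fun p : ℕ × ℕ × List Bool =>
        stringOccurrences w (2 ^ p.1) p.2.2 := (primrec_stringOccurrences w).comp hp hs
    refine PrimrecPred.and (Primrec.nat_le.comp (Primrec.nat_add.comp
      (Primrec.fst.comp Primrec.snd) (Primrec.const K)) Primrec.fst) (PrimrecPred.and
      (Primrec.eq.comp (Primrec.list_length.comp hs) (Primrec.nat_add.comp hp (Primrec.const _)))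
      (Primrec.nat_lt.comp (Primrec.nat_add.comp (Primrec.nat_mul.comp (Primrec.const c) (ho _)) hp)
        (Primrec.nat_mul.comp (Primrec.const d) (ho _))))
  have hE : PrimrecPred fun q : ℕ × List Bool => q.2 ∈ frequencyTest w b a c d K q.1 :=
    (hR.exists_mem_list.comp (Primrec.list_range.comp (Primrec.list_length.comp Primrec.snd))
      Primrec.id).of_eq (by simp [frequencyTest])
  exact hE.computablePred.to_re

theorem openSetOf_frequencyTest_subset (w : List Bool) (b a : Bool) (c d K n : ℕ) :
    openSetOf (frequencyTest w b a c d K n) ⊆ ⋃ j : ℕ,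
      {ω | c * occurrences (w ++ [b]) (2 ^ (j + (n + K))) ω + 2 ^ (j + (n + K)) <
        d * occurrences (w ++ [b] ++ [a]) (2 ^ (j + (n + K))) ω} := by
  intro ω hω
  simp only [openSetOf, Set.mem_iUnion, exists_prop] at hω
  obtain ⟨s, ⟨k, -, hk, hl, h⟩, hω⟩ := hω
  rw [stringOccurrences_eq hω (by simp; omega), stringOccurrences_eq hω (by simp; omega)] at h
  refine Set.mem_iUnion.2 ⟨k - (n + K), ?_⟩
  rwa [Nat.sub_add_cancel hk]

theorem mem_openSetOf_frequencyTest {w : List Bool} {b a : Bool} {c d K n k : ℕ} {ω : History}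
    (hk : n + K ≤ k) (h : c * occurrences (w ++ [b]) (2 ^ k) ω + 2 ^ k <
      d * occurrences (w ++ [b] ++ [a]) (2 ^ k) ω) :
    ω ∈ openSetOf (frequencyTest w b a c d K n) := by
  have hω := mem_cylinderOfString_historyPrefix_self (2 ^ k + (w.length + 2)) ω
  have hlt : k < 2 ^ k := Nat.lt_two_pow_self
  refine Set.mem_biUnion ⟨k, by simp; omega, hk, by simp, ?_⟩ hω
  rwa [stringOccurrences_eq hω (by simp), stringOccurrences_eq hω (by simp)]

theorem isMartinLofTest_frequencyTest (P : TransitionMatrix) (w : List Bool) (b a : Bool)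
    {c d : ℕ} (hcd : P.1 b a * d ≤ c) :
    IsMartinLofTest (markovMeasure P) (frequencyTest w b a c d (2 * d ^ 2)) := by
  refine ⟨rePred_frequencyTest w b a c d _, fun n => ?_⟩
  -- The tail of the Chebyshev bounds from `n + K` on is `2 * d ^ 2 * 2⁻¹ ^ (n + K)`; with `K = 2 *
  -- d ^ 2` the constant is absorbed, since `m ≤ 2 ^ m`.
  have hd : ((d ^ 2 * 2 : ℕ) : ℝ≥0∞) * 2⁻¹ ^ (2 * d ^ 2) ≤ 1 := by
    rw [← ENNReal.inv_pow, ← div_eq_mul_inv]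
    refine ENNReal.div_le_of_le_mul ?_
    rw [one_mul]
    have : d ^ 2 * 2 ≤ 2 ^ (2 * d ^ 2) := by
      rw [mul_comm]
      exact Nat.lt_two_pow_self.le
    exact_mod_cast this
  calc markovMeasure P (openSetOf (frequencyTest w b a c d (2 * d ^ 2) n))
      ≤ ∑' j : ℕ, markovMeasure P _ :=
        (measure_mono (openSetOf_frequencyTest_subset w b a c d _ n)).trans (measure_iUnion_le _)
    _ ≤ ∑' j : ℕ, (d ^ 2 * (2 : ℝ≥0∞)⁻¹ ^ (n + 2 * d ^ 2)) * 2⁻¹ ^ j :=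
        ENNReal.tsum_le_tsum fun j =>
          (markovMeasure_setOf_occurrences_lt_le P w b a hcd _).trans (le_of_eq (by ring))
    _ = (2 : ℝ≥0∞)⁻¹ ^ n * (((d ^ 2 * 2 : ℕ) : ℝ≥0∞) * 2⁻¹ ^ (2 * d ^ 2)) := by
        rw [ENNReal.tsum_mul_left, ENNReal.tsum_geometric, ENNReal.one_sub_inv_two, inv_inv]
        push_cast
        ring
    _ ≤ 2⁻¹ ^ n := mul_le_of_le_one_right' hd

/-- The histories in which, up to `o(n)`, each word is followed by each letter at most as often as
the transition matrix predicts, along the times `n = 2 ^ k`. -/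
def frequencyLaw (P : TransitionMatrix) : Set History :=
  {ω | ∀ (w : List Bool) (b a : Bool) (c d : ℕ), P.1 b a * d ≤ c → ∃ C : ℕ, ∀ k : ℕ,
    d * occurrences (w ++ [b] ++ [a]) (2 ^ k) ω ≤
      c * occurrences (w ++ [b]) (2 ^ k) ω + 2 ^ k + C}

theorem starLaw_subset_frequencyLaw (P : TransitionMatrix) :
    starLaw (markovMeasure P) ⊆ frequencyLaw P := by
  intro ω hω w b a c d hcd
  have := hω _ (isMartinLofTest_frequencyTest P w b a hcd)
  simp only [Set.mem_iInter, not_forall] at this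
  obtain ⟨n, hn⟩ := this
  -- At a level `n` that is passed, the inequality holds without `C` for `k ≥ n + 2 * d ^ 2`; the
  -- constant covers the finitely many earlier times.
  refine ⟨d * 2 ^ (n + 2 * d ^ 2), fun k => ?_⟩
  rcases le_or_gt (n + 2 * d ^ 2) k with hk | hk
  · have := mt (mem_openSetOf_frequencyTest hk) hn
    omega
  · have h1 := occurrences_le (w ++ [b] ++ [a]) (2 ^ k) ω
    have h2 : 2 ^ k ≤ 2 ^ (n + 2 * d ^ 2) := Nat.pow_le_pow_right (by norm_num) hk.le
    exact (Nat.mul_le_mul_left d (h1.trans h2)).trans (Nat.le_add_left _ _)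

theorem measurableSet_frequencyLaw (P : TransitionMatrix) : MeasurableSet (frequencyLaw P) := by
  simp only [frequencyLaw, Set.ofPred_forall, Set.ofPred_exists]
  refine .iInter fun w => .iInter fun b => .iInter fun a => .iInter fun c => .iInter fun d =>
    .iInter fun _ => .iUnion fun C => .iInter fun k => ?_
  exact measurableSet_le ((measurable_occurrences _ _).const_mul _)
    ((((measurable_occurrences _ _).const_mul _).add_const _).add_const _)

/-! ### Almost every history is Martin-Löf random -/

/-- Each such sequence is the domain of a partial recursive function, and there are countably many
codes. -/
theorem countable_setOf_rePred :
    {U : ℕ → Set (List Bool) | REPred fun q : ℕ × List Bool => q.2 ∈ U q.1}.Countable := by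
  refine (Set.countable_range fun (c : Nat.Partrec.Code) (n : ℕ) =>
    {s : List Bool | (c.eval (Encodable.encode (n, s))).Dom}).mono fun U hU => ?_
  obtain ⟨c, hc⟩ := Nat.Partrec.Code.exists_code.1 hU
  refine ⟨c, funext fun n => Set.ext fun s => ?_⟩
  simp [hc, Part.assert]

theorem measurableSet_openSetOf (A : Set (List Bool)) : MeasurableSet (openSetOf A) :=
  MeasurableSet.biUnion A.to_countable fun s _ => measurableSet_cylinderOfString s

theorem compl_starLaw (μ : Measure History) :
    (starLaw μ)ᶜ = ⋃ U ∈ {U | IsMartinLofTest μ U}, ⋂ n, openSetOf (U n) := by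
  ext ω
  simp [starLaw]

theorem countable_setOf_isMartinLofTest (μ : Measure History) :
    {U | IsMartinLofTest μ U}.Countable :=
  countable_setOf_rePred.mono fun _ h => h.1

theorem measurableSet_starLaw (μ : Measure History) : MeasurableSet (starLaw μ) := by
  rw [← MeasurableSet.compl_iff, compl_starLaw]
  exact MeasurableSet.biUnion (countable_setOf_isMartinLofTest μ) fun U _ =>
    MeasurableSet.iInter fun n => measurableSet_openSetOf _

theorem measure_compl_starLaw (μ : Measure History) : μ (starLaw μ)ᶜ = 0 := by
  rw [compl_starLaw, measure_biUnion_null_iff (countable_setOf_isMartinLofTest μ)]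
  intro U hU
  refine le_antisymm (ge_of_tendsto' (ENNReal.tendsto_pow_atTop_nhds_zero_of_lt_one
    (by simp : (2 : ℝ≥0∞)⁻¹ < 1)) fun n => ?_) zero_le
  exact (measure_mono (Set.iInter_subset _ n)).trans (hU.2 n)

/-! ### Invariance of the frequency law -/

/-- A bounded change of all counts is absorbed by the constant `C`; this is why the law is stated
with one. -/
theorem mem_frequencyLaw_of_occurrences_le {P : TransitionMatrix} {ω ω' : History} (m : ℕ)
    (h : ∀ w n, occurrences w n ω' ≤ occurrences w n ω + m)
    (h' : ∀ w n, occurrences w n ω ≤ occurrences w n ω' + m) (hω : ω ∈ frequencyLaw P) :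
    ω' ∈ frequencyLaw P := by
  intro w b a c d hcd
  obtain ⟨C, hC⟩ := hω w b a c d hcd
  refine ⟨C + d * m + c * m, fun k => ?_⟩
  have h1 := Nat.mul_le_mul_left d (h (w ++ [b] ++ [a]) (2 ^ k))
  have h2 := Nat.mul_le_mul_left c (h' (w ++ [b]) (2 ^ k))
  rw [Nat.mul_add] at h1 h2
  have h3 := hC k
  omega

/-- The shift drops the window at 0 and gains the one at `n`, so each count changes by at most one.
-/
theorem preimage_timeShift_frequencyLaw (P : TransitionMatrix) :
    timeShift 1 ⁻¹' frequencyLaw P = frequencyLaw P := by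
  have key (w : List Bool) (n : ℕ) (ω : History) :
      occurrences w n (timeShift 1 ω) ≤ occurrences w n ω + 1 ∧
        occurrences w n ω ≤ occurrences w n (timeShift 1 ω) + 1 := by
    have e1 := occurrences_succ w n ω
    have e2 : occurrences w (n + 1) ω =
        occurrences w n (timeShift 1 ω) + (cylinderOfString w).indicator 1 ω := by
      simp [occurrences, Finset.sum_range_succ', timeShift_timeShift]
    have b (ω' : History) : (cylinderOfString w).indicator (1 : History → ℕ) ω' ≤ 1 :=
      Set.indicator_le_self' (fun _ _ => zero_le) ω'
    have := b ω
    have := b (timeShift n ω)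
    omega
  ext ω
  exact ⟨mem_frequencyLaw_of_occurrences_le 1 (fun w n => (key w n ω).2) fun w n => (key w n ω).1,
    mem_frequencyLaw_of_occurrences_le 1 (fun w n => (key w n ω).1) fun w n => (key w n ω).2⟩

/-- Only windows that start before `m` can differ. -/
theorem occurrences_le_of_eventually_eq {ω ω' : History} {m : ℕ} (h : ∀ i, m ≤ i → ω i = ω' i)
    (w : List Bool) (n : ℕ) : occurrences w n ω ≤ occurrences w n ω' + m := by
  have key (i : ℕ) : (cylinderOfString w).indicator (1 : History → ℕ) (timeShift i ω) ≤
      (cylinderOfString w).indicator (1 : History → ℕ) (timeShift i ω') +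
        if i < m then 1 else 0 := by
    split_ifs with hi
    · exact (Set.indicator_le_self' (fun _ _ => zero_le) _).trans (Nat.le_add_left _ _)
    · have : timeShift i ω = timeShift i ω' := funext fun j => h _ (by omega)
      rw [this, add_zero]
  refine (Finset.sum_le_sum fun i _ => key i).trans ?_
  rw [Finset.sum_add_distrib, Finset.sum_boole]
  refine Nat.add_le_add_left ?_ _
  have : (Finset.range n).filter (· < m) ⊆ Finset.range m := fun i hi => by simp_all
  simpa using Finset.card_le_card this

theorem mem_frequencyLaw_congr {P : TransitionMatrix} {ω ω' : History} {m : ℕ}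
    (h : ∀ i, m ≤ i → ω i = ω' i) : ω ∈ frequencyLaw P ↔ ω' ∈ frequencyLaw P :=
  ⟨mem_frequencyLaw_of_occurrences_le m
      (occurrences_le_of_eventually_eq fun i hi => (h i hi).symm)
      (occurrences_le_of_eventually_eq h),
    mem_frequencyLaw_of_occurrences_le m (occurrences_le_of_eventually_eq h)
      (occurrences_le_of_eventually_eq fun i hi => (h i hi).symm)⟩

/-! ### Stationary measures on the frequency law -/

theorem integral_occurrences {ν : Measure History} [IsFiniteMeasure ν] (h : HasStationaryLaw ν)
    (w : List Bool) (n : ℕ) :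
    ∫ ω, (occurrences w n ω : ℝ) ∂ν = n * ν.real (cylinderOfString w) := by
  have hc (η : History) : (((cylinderOfString w).indicator 1 η : ℕ) : ℝ) =
      (cylinderOfString w).indicator 1 η := by
    by_cases h : η ∈ cylinderOfString w <;> simp [h]
  have hi : Integrable ((cylinderOfString w).indicator (1 : History → ℝ)) ν :=
    (integrable_const (1 : ℝ)).indicator (measurableSet_cylinderOfString w)
  simp only [occurrences, Nat.cast_sum, hc]
  have his (i : ℕ) : Integrable
      (fun ω => (cylinderOfString w).indicator (1 : History → ℝ) (timeShift i ω)) ν :=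
    (h.measurePreserving_timeShift i).integrable_comp_of_integrable hi
  rw [integral_finsetSum _ fun i _ => his i]
  have (i : ℕ) : ∫ ω, (cylinderOfString w).indicator (1 : History → ℝ) (timeShift i ω) ∂ν =
      ν.real (cylinderOfString w) := by
    rw [← integral_indicator_one (measurableSet_cylinderOfString w)]
    conv_rhs => rw [← (h.measurePreserving_timeShift i).map_eq]
    rw [integral_map (measurable_timeShift i).aemeasurable]
    exact (measurable_one.indicator (measurableSet_cylinderOfString w)).aestronglyMeasurable
  simp [this]

/-- Divide the frequency inequality by `2 ^ k` and integrate. By stationarity the mean of the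
left-hand quantity `X k` does not depend on `k`, while the positive part of `X k - 1` tends to 0
boundedly. Convergence of the frequencies themselves is not required. -/
theorem mul_measureReal_cylinderOfString_concat_le {ν : Measure History} [IsFiniteMeasure ν]
    (h : HasStationaryLaw ν) {P : TransitionMatrix} (hF : ∀ᵐ ω ∂ν, ω ∈ frequencyLaw P)
    (w : List Bool) (b a : Bool) {c d : ℕ} (hcd : P.1 b a * d ≤ c) :
    d * ν.real (cylinderOfString (w ++ [b] ++ [a])) ≤
      c * ν.real (cylinderOfString (w ++ [b])) + ν.real Set.univ := by
  set X : ℕ → History → ℝ := fun k ω => d * (occurrences (w ++ [b] ++ [a]) (2 ^ k) ω / 2 ^ k) -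
    c * (occurrences (w ++ [b]) (2 ^ k) ω / 2 ^ k) with hX
  have hocc (w : List Bool) (k : ℕ) :
      Measurable fun ω => (occurrences w (2 ^ k) ω / 2 ^ k : ℝ) :=
    ((measurable_from_top (f := fun n : ℕ => (n : ℝ))).comp
      (measurable_occurrences w (2 ^ k))).div_const _
  have hocc0 (w : List Bool) (k : ℕ) (ω : History) :
      (0 : ℝ) ≤ occurrences w (2 ^ k) ω / 2 ^ k := by positivity
  have hocc1 (w : List Bool) (k : ℕ) (ω : History) :
      (occurrences w (2 ^ k) ω / 2 ^ k : ℝ) ≤ 1 := by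
    rw [div_le_one (by positivity)]
    exact_mod_cast occurrences_le w (2 ^ k) ω
  have hocci (w : List Bool) (k : ℕ) :
      Integrable (fun ω => (occurrences w (2 ^ k) ω / 2 ^ k : ℝ)) ν := by
    refine Integrable.of_bound (hocc w k).aestronglyMeasurable 1 (ae_of_all _ fun ω => ?_)
    rw [Real.norm_eq_abs, abs_of_nonneg (hocc0 w k ω)]
    exact hocc1 w k ω
  have hmean (w : List Bool) (k : ℕ) :
      ∫ ω, (occurrences w (2 ^ k) ω / 2 ^ k : ℝ) ∂ν = ν.real (cylinderOfString w) := by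
    rw [integral_div, integral_occurrences h]
    push_cast
    field_simp
  have hXi (k : ℕ) : Integrable (X k) ν := ((hocci _ k).const_mul _).sub ((hocci _ k).const_mul _)
  have hXint (k : ℕ) : ∫ ω, X k ω ∂ν = d * ν.real (cylinderOfString (w ++ [b] ++ [a])) -
      c * ν.real (cylinderOfString (w ++ [b])) := by
    simp only [hX]
    rw [integral_sub ((hocci _ k).const_mul _) ((hocci _ k).const_mul _), integral_const_mul,
      integral_const_mul, hmean, hmean]
  have hYm (k : ℕ) : Measurable fun ω => max (X k ω - 1) 0 :=
    ((((hocc _ k).const_mul _).sub ((hocc _ k).const_mul _)).sub_const 1).max measurable_const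
  have hYb (k : ℕ) (ω : History) : ‖max (X k ω - 1) 0‖ ≤ d := by
    rw [Real.norm_eq_abs, abs_of_nonneg (le_max_right _ _)]
    refine max_le ?_ d.cast_nonneg
    have h1 := mul_le_mul_of_nonneg_left (hocc1 (w ++ [b] ++ [a]) k ω) (Nat.cast_nonneg (α := ℝ) d)
    have h2 := mul_nonneg (Nat.cast_nonneg (α := ℝ) c) (hocc0 (w ++ [b]) k ω)
    simp only [hX]
    linarith
  have hlim : Filter.Tendsto (fun k => ∫ ω, max (X k ω - 1) 0 ∂ν) Filter.atTop
      (nhds (∫ _, (0 : ℝ) ∂ν)) := by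
    refine tendsto_integral_of_dominated_convergence (fun _ => (d : ℝ))
      (fun k => (hYm k).aestronglyMeasurable) (integrable_const _)
      (fun k => ae_of_all _ (hYb k)) ?_
    filter_upwards [hF] with ω hω
    obtain ⟨C, hC⟩ := hω w b a c d hcd
    refine squeeze_zero (g := fun k : ℕ => (C : ℝ) * (1 / 2) ^ k) (fun k => le_max_right _ _)
      (fun k => max_le ?_ (by positivity)) ?_
    · have := hC k
      have h1 : (d * occurrences (w ++ [b] ++ [a]) (2 ^ k) ω : ℝ) ≤
          c * occurrences (w ++ [b]) (2 ^ k) ω + 2 ^ k + C := by exact_mod_cast this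
      have h2 : (0 : ℝ) < 2 ^ k := by positivity
      rw [one_div, inv_pow]
      simp only [hX]
      rw [← sub_nonneg]
      have h3 : (C : ℝ) * (2 ^ k)⁻¹ - (d * (occurrences (w ++ [b] ++ [a]) (2 ^ k) ω / 2 ^ k) -
          c * (occurrences (w ++ [b]) (2 ^ k) ω / 2 ^ k) - 1) =
          (c * occurrences (w ++ [b]) (2 ^ k) ω + 2 ^ k + C -
            d * occurrences (w ++ [b] ++ [a]) (2 ^ k) ω) / 2 ^ k := by
        field_simp
        ring
      rw [h3]
      exact div_nonneg (by linarith) h2.le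
    · simpa using (tendsto_pow_atTop_nhds_zero_of_lt_one (by norm_num : (0 : ℝ) ≤ 1 / 2)
        (by norm_num)).const_mul (C : ℝ)
  rw [integral_zero] at hlim
  have hbound (k : ℕ) : d * ν.real (cylinderOfString (w ++ [b] ++ [a])) -
      c * ν.real (cylinderOfString (w ++ [b])) - ν.real Set.univ ≤
        ∫ ω, max (X k ω - 1) 0 ∂ν := by
    rw [← hXint k]
    have e : ∫ _, (1 : ℝ) ∂ν = ν.real Set.univ := by simp
    rw [← e, ← integral_sub (hXi k) (integrable_const 1)]
    refine integral_mono ((hXi k).sub (integrable_const 1)) ?_ fun ω => le_max_left _ _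
    exact Integrable.of_bound (hYm k).aestronglyMeasurable d (ae_of_all _ (hYb k))
  have := ge_of_tendsto' hlim hbound
  linarith

theorem measureReal_cylinderOfString_concat_eq {ν : Measure History} [IsFiniteMeasure ν]
    (h : HasStationaryLaw ν) {P : TransitionMatrix} (hF : ∀ᵐ ω ∂ν, ω ∈ frequencyLaw P)
    (w : List Bool) (b a : Bool) :
    ν.real (cylinderOfString (w ++ [b] ++ [a])) =
      P.1 b a * ν.real (cylinderOfString (w ++ [b])) := by
  have hle (a : Bool) : ν.real (cylinderOfString (w ++ [b] ++ [a])) ≤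
      P.1 b a * ν.real (cylinderOfString (w ++ [b])) := by
    have h1 (d : ℕ) : d * (ν.real (cylinderOfString (w ++ [b] ++ [a])) -
        P.1 b a * ν.real (cylinderOfString (w ++ [b]))) ≤ 2 * ν.real Set.univ := by
      -- Rounding `P.1 b a * d` up costs at most one further total mass, so the excess is at most `2
      -- / d` times the total mass for every `d > 0`.
      have h2 := mul_measureReal_cylinderOfString_concat_le h hF w b a (Nat.le_ceil (P.1 b a * d))
      have h3 := (Nat.ceil_lt_add_one (mul_nonneg (P.nonneg b a) d.cast_nonneg)).le
      have h4 := mul_le_mul_of_nonneg_right h3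
        (measureReal_nonneg (μ := ν) (s := cylinderOfString (w ++ [b])))
      have h5 : ν.real (cylinderOfString (w ++ [b])) ≤ ν.real Set.univ :=
        measureReal_mono (Set.subset_univ _)
      nlinarith
    by_contra! hlt
    obtain ⟨d, hd⟩ := exists_nat_gt (2 * ν.real Set.univ /
      (ν.real (cylinderOfString (w ++ [b] ++ [a])) -
        P.1 b a * ν.real (cylinderOfString (w ++ [b]))))
    rw [div_lt_iff₀ (by linarith)] at hd
    exact absurd (h1 d) (not_le.2 hd)
  -- Over the two letters, both sides of the inequality add up to the probability of `w ++ [b]`, so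
  -- neither inequality is strict.
  have hsum : ν.real (cylinderOfString (w ++ [b])) =
      ν.real (cylinderOfString (w ++ [b] ++ [true])) +
        ν.real (cylinderOfString (w ++ [b] ++ [false])) := by
    simp only [measureReal_def]
    rw [measure_cylinderOfString_eq_add_concat,
      ENNReal.toReal_add (measure_ne_top _ _) (measure_ne_top _ _)]
  have h1 := hle true
  have h2 := hle false
  have h3 : ν.real (cylinderOfString (w ++ [b])) = P.1 b true * ν.real (cylinderOfString (w ++ [b]))
      + P.1 b false * ν.real (cylinderOfString (w ++ [b])) := by
    rw [← add_mul, P.row_sum, one_mul]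
  cases a <;> linarith

/-- A stationary measure that is carried by the frequency law of `P` is a multiple of `γ_P`. -/
theorem eq_smul_markovMeasure_of_ae_mem_frequencyLaw {ν : Measure History} [IsFiniteMeasure ν]
    (h : HasStationaryLaw ν) {P : TransitionMatrix} (hF : ∀ᵐ ω ∂ν, ω ∈ frequencyLaw P) :
    ν = ν Set.univ • markovMeasure P := by
  rcases eq_or_ne ν 0 with rfl | h0
  · simp
  have hpos : 0 < ν.real Set.univ := by
    rw [measureReal_def]
    exact ENNReal.toReal_pos (by simpa using h0) (measure_ne_top _ _)
  have key := measureReal_cylinderOfString_concat_eq h hF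
  -- The normalized one-letter probabilities are a stationary distribution; uniqueness identifies
  -- them with that of `P`.
  have hp : IsStationaryDistribution P.1
      fun b => ν.real (cylinderOfString [b]) / ν.real Set.univ := by
    refine ⟨⟨fun b => div_nonneg measureReal_nonneg hpos.le, ?_⟩, ?_⟩
    · have u : cylinderOfString [] = Set.univ := by ext; simp
      have e := measure_cylinderOfString_eq_add_concat ν []
      rw [u] at e
      rw [Fintype.sum_bool, ← add_div, div_eq_one_iff_eq hpos.ne']
      simp only [measureReal_def]
      rw [e, ENNReal.toReal_add (measure_ne_top _ _) (measure_ne_top _ _)]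
      rfl
    · funext b
      have e : ν.real (cylinderOfString [b]) =
          ν.real (cylinderOfString [true, b]) + ν.real (cylinderOfString [false, b]) := by
        simp only [measureReal_def]
        rw [← ENNReal.toReal_add (measure_ne_top _ _) (measure_ne_top _ _),
          ← measure_timeShift_preimage_eq_add_cons,
          h.measure_preimage (measurableSet_cylinderOfString _).nullMeasurableSet]
      have k (c : Bool) := key [] c b
      simp only [List.nil_append, List.cons_append] at k
      simp only [Matrix.vecMul, dotProduct, Fintype.sum_bool]
      rw [e, k, k]
      ring
  refine eq_smul_markovMeasure P _ (fun b => ?_) fun s b a => ?_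
  · rw [← P.eq_stationaryDistribution hp, ENNReal.ofReal_div_of_pos hpos, ofReal_measureReal,
      ofReal_measureReal, ENNReal.mul_div_cancel (by simpa using h0) (measure_ne_top _ _)]
  · rw [← ofReal_measureReal, key, ENNReal.ofReal_mul (P.nonneg b a), ofReal_measureReal, mul_comm]

theorem HasStationaryLaw.restrict_frequencyLaw {ν : Measure History} [IsFiniteMeasure ν]
    (h : HasStationaryLaw ν) (P : TransitionMatrix) :
    ν.restrict (frequencyLaw P) = ν (frequencyLaw P) • markovMeasure P := by
  have hs : HasStationaryLaw (ν.restrict (frequencyLaw P)) := by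
    have := MeasurePreserving.restrict_preimage h (measurableSet_frequencyLaw P)
    rwa [preimage_timeShift_frequencyLaw] at this
  have := eq_smul_markovMeasure_of_ae_mem_frequencyLaw hs
    (ae_restrict_mem (measurableSet_frequencyLaw P))
  rwa [Measure.restrict_apply_univ] at this

/-- The star law lies in the frequency law and has full γ_P-measure, so the multiple of γ_P found on
the frequency law is already carried by it; `A = univ` identifies the factor. -/
theorem HasStationaryLaw.measure_starLaw_inter {ν : Measure History} [IsFiniteMeasure ν]
    (h : HasStationaryLaw ν) (P : TransitionMatrix) {A : Set History} (hA : MeasurableSet A) :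
    ν (starLaw (markovMeasure P) ∩ A) =
      ν (starLaw (markovMeasure P)) * markovMeasure P A := by
  have key {A : Set History} (hA : MeasurableSet A) : ν (starLaw (markovMeasure P) ∩ A) =
      ν (frequencyLaw P) * markovMeasure P A := by
    have := congrArg (fun μ => μ (starLaw (markovMeasure P) ∩ A)) (h.restrict_frequencyLaw P)
    simp only [Measure.smul_apply, smul_eq_mul] at this
    rw [Measure.restrict_apply ((measurableSet_starLaw _).inter hA), Set.inter_assoc,
      Set.inter_comm A, ← Set.inter_assoc,
      Set.inter_eq_left.2 (starLaw_subset_frequencyLaw P)] at this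
    rw [this, Set.inter_comm, measure_inter_conull (measure_compl_starLaw _)]
  have h1 := key MeasurableSet.univ
  rw [Set.inter_univ, measure_univ, mul_one] at h1
  rw [key hA, h1]

theorem HasStationaryLaw.measure_starLaw {ν : Measure History} [IsFiniteMeasure ν]
    (h : HasStationaryLaw ν) (P : TransitionMatrix) :
    ν (starLaw (markovMeasure P)) = ν (frequencyLaw P) := by
  have := congrArg (fun μ => μ (starLaw (markovMeasure P))) (h.restrict_frequencyLaw P)
  simp only [Measure.smul_apply, smul_eq_mul] at this
  rwa [Measure.restrict_apply (measurableSet_starLaw _),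
    Set.inter_eq_left.2 (starLaw_subset_frequencyLaw P),
    (prob_compl_eq_zero_iff (measurableSet_starLaw _)).1 (measure_compl_starLaw _), mul_one] at this

/-- Apply the factorization twice. With γ_P as the stationary measure, it shows that γ_Q is carried
by the star law of γ_P; with γ_Q as the stationary measure, it then gives equality. -/
theorem markovMeasure_eq_of_measure_starLaw_ne_zero {P Q : TransitionMatrix}
    (h : markovMeasure P (starLaw (markovMeasure Q)) ≠ 0) :
    markovMeasure P = markovMeasure Q := by
  have h1 := (hasStationaryLaw_markovMeasure P).measure_starLaw_inter Q
    (measurableSet_starLaw (markovMeasure P)).compl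
  rw [measure_mono_null Set.inter_subset_right (measure_compl_starLaw _), eq_comm, mul_eq_zero,
    or_iff_right h] at h1
  refine Measure.ext fun A hA => ?_
  have h2 := (hasStationaryLaw_markovMeasure Q).measure_starLaw_inter P hA
  rw [Set.inter_comm, measure_inter_conull h1,
    (prob_compl_eq_zero_iff (measurableSet_starLaw _)).1 h1, one_mul] at h2
  exact h2.symm

/-! ### Exchangeable measures on the frequency law -/

/-- Short words are sums of longer ones. The swap below needs words long enough to contain both
positions. -/
theorem measure_ext_of_long_cylinderOfString {μ ν : Measure History} [IsFiniteMeasure μ] (m : ℕ)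
    (h : ∀ s : List Bool, m ≤ s.length → μ (cylinderOfString s) = ν (cylinderOfString s)) :
    μ = ν := by
  have key (j : ℕ) : ∀ s : List Bool, m ≤ s.length + j →
      μ (cylinderOfString s) = ν (cylinderOfString s) := by
    induction j with
    | zero => exact h
    | succ j ih =>
      intro s hs
      rw [measure_cylinderOfString_eq_add_concat μ, measure_cylinderOfString_eq_add_concat ν,
        ih _ (by simp; omega), ih _ (by simp; omega)]
  exact measure_ext_of_cylinderOfString fun s => key m s (by omega)

theorem IsExchangeable.measurePreserving_swap {ν : Measure History} [IsFiniteMeasure ν]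
    (h : IsExchangeable ν) (i j : ℕ) :
    MeasurePreserving (fun (ω : History) k => ω (Equiv.swap i j k)) ν ν := by
  have hm : Measurable fun (ω : History) k => ω (Equiv.swap i j k) :=
    measurable_pi_lambda _ fun _ => measurable_pi_apply _
  refine ⟨hm, measure_ext_of_long_cylinderOfString (max i j + 1) fun s hs => ?_⟩
  have hi : i < s.length := by omega
  have hj : j < s.length := by omega
  rw [Measure.map_apply hm (measurableSet_cylinderOfString s)]
  have e : (fun (ω : History) k => ω (Equiv.swap i j k)) ⁻¹' cylinderOfString s =
      {ω | ∀ k : Fin s.length, ω (Equiv.swap (⟨i, hi⟩ : Fin s.length) ⟨j, hj⟩ k) = s.get k} := by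
    ext ω
    refine forall_congr' fun k => ?_
    rw [← Fin.val_injective.swap_apply]
  rw [e]
  exact (h _ s.get _).symm

/-- The hypothesis reads p(H) P(H,T) P(H,H) = p(H) P(H,T) P(T,H). If p(H) P(H,T) ≠ 0, the two rows
agree and equal p. Otherwise there is no flow between the states, and the chain stays in one of
them. -/
theorem exists_markovMeasure_eq_iidMeasure {P : TransitionMatrix}
    (h : markovMeasure P (cylinderOfString [true, true, false]) =
      markovMeasure P (cylinderOfString [true, false, true])) :
    ∃ θ, markovMeasure P = iidMeasure θ := by
  set p := P.stationaryDistribution with hp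
  have hcyl (a b c : Bool) : markovMeasure P (cylinderOfString [a, b, c]) =
      ENNReal.ofReal (p a * P.1 a b * P.1 b c) := by
    rw [ENNReal.ofReal_mul (mul_nonneg (P.stationaryDistribution_nonneg a) (P.nonneg a b)),
      ENNReal.ofReal_mul (P.stationaryDistribution_nonneg a),
      ← markovMeasure_cylinderOfString_singleton]
    have h1 := markovMeasure_cylinderOfString_concat_concat P [] a b
    have h2 := markovMeasure_cylinderOfString_concat_concat P [a] b c
    simp only [List.nil_append, List.cons_append] at h1 h2
    rw [h2, h1]
  have hn (a b c : Bool) : 0 ≤ p a * P.1 a b * P.1 b c :=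
    mul_nonneg (mul_nonneg (P.stationaryDistribution_nonneg a) (P.nonneg a b)) (P.nonneg b c)
  rw [hcyl, hcyl, ENNReal.ofReal_eq_ofReal_iff (hn _ _ _) (hn _ _ _)] at h
  have hs := P.stationaryDistribution_spec
  have s1 : p true * P.1 true true + p false * P.1 false true = p true := hs.sum_eq true
  have s2 : p true + p false = 1 := hs.sum_eq_one
  have r1 := P.row_sum true
  have r2 := P.row_sum false
  have p0 := P.stationaryDistribution_nonneg true
  have p1 := P.stationaryDistribution_nonneg false
  refine ⟨⟨p true, p0, by linarith⟩, markovMeasure_eq_iidMeasure P _ ?_⟩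
  have main (b : Bool) : p b * P.1 b true = p b * p true := by
    by_cases hz : p true * P.1 true false = 0
    · have hz' : p false * P.1 false true = 0 := by
        have : P.1 true true = 1 - P.1 true false := by linarith
        rw [this] at s1
        linarith
      rcases mul_eq_zero.1 hz with ht | ht
      · cases b
        · rw [hz', ht, mul_zero]
        · rw [ht, zero_mul, zero_mul]
      · have htt : P.1 true true = 1 := by linarith
        have hf : p false = 0 := by
          rcases mul_eq_zero.1 hz' with hf | hf
          · exact hf
          -- Heads is absorbing, so its point mass is stationary; uniqueness excludes any weight on
          -- tails.
          · have hid : IsStationaryDistribution P.1 fun b => if b then 1 else 0 := by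
              refine ⟨⟨fun b => by cases b <;> simp, by simp⟩, funext fun b => ?_⟩
              cases b <;> simp [Matrix.vecMul, dotProduct, ht, htt]
            have := congrFun (P.eq_stationaryDistribution hid) false
            simpa using this.symm
        have ht1 : p true = 1 := by linarith
        cases b
        · rw [hf, zero_mul, zero_mul]
        · rw [htt, ht1]
    · have e : P.1 true true = P.1 false true := by
        refine mul_left_cancel₀ hz ?_
        linarith
      have ep : P.1 true true = p true := by
        rw [← e, ← add_mul, s2, one_mul] at s1
        exact s1
      cases b
      · rw [← e, ep]
      · rw [ep]
  intro b a
  cases a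
  · have := P.row_sum b
    have e : P.1 b false = 1 - P.1 b true := by linarith
    simp only [tossWeight, e, mul_sub, Bool.false_eq_true, if_false, ← hp, main]
  · simpa [tossWeight] using main b

theorem IsExchangeable.exists_markovMeasure_eq_iidMeasure {ν : Measure History}
    [IsFiniteMeasure ν] (h : IsExchangeable ν) {P : TransitionMatrix}
    (h0 : ν (starLaw (markovMeasure P)) ≠ 0) : ∃ θ, markovMeasure P = iidMeasure θ := by
  apply _root_.exists_markovMeasure_eq_iidMeasure
  rw [h.hasStationaryLaw.measure_starLaw] at h0
  have hr := h.hasStationaryLaw.restrict_frequencyLaw P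
  have key (s : List Bool) : ν (frequencyLaw P) * markovMeasure P (cylinderOfString s) =
      ν (cylinderOfString s ∩ frequencyLaw P) := by
    have := congrArg (fun μ => μ (cylinderOfString s)) hr
    simp only [Measure.smul_apply, smul_eq_mul] at this
    rw [← this, Measure.restrict_apply (measurableSet_cylinderOfString s)]
  refine (ENNReal.mul_right_inj h0 (measure_ne_top _ _)).1 ?_
  -- Swapping coordinates 1 and 2 exchanges the two words and leaves every toss from time 3 on
  -- unchanged, hence preserves the frequency law.
  rw [key, key, ← (h.measurePreserving_swap 1 2).measure_preimage
    ((measurableSet_cylinderOfString _).inter (measurableSet_frequencyLaw P)).nullMeasurableSet]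
  congr 1
  ext ω
  rw [Set.mem_preimage, Set.mem_inter_iff, Set.mem_inter_iff]
  refine and_congr ?_ (mem_frequencyLaw_congr (m := 3) fun i hi => ?_)
  · have e0 : Equiv.swap 1 2 0 = 0 := by decide
    have e1 : Equiv.swap 1 2 1 = 2 := by decide
    have e2 : Equiv.swap 1 2 2 = 1 := by decide
    simp [timeShift, e0, e1, e2]
    tauto
  · rw [Equiv.swap_apply_of_ne_of_ne (by omega) (by omega)]

/-! ### The Markov property -/

/-- The future given a past that ends in `b` does not depend on that past. The cross-multiplied form
allows null pasts and turns both sides into finite measures in `A`, which need only be compared on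
cylinders. -/
theorem markovMeasure_inter_preimage_timeShift (P : TransitionMatrix) (s t : List Bool) (b : Bool)
    {A : Set History} (hA : MeasurableSet A) :
    markovMeasure P (cylinderOfString (s ++ [b]) ∩ timeShift (s.length + 1) ⁻¹' A) *
        markovMeasure P (cylinderOfString (t ++ [b])) =
      markovMeasure P (cylinderOfString (t ++ [b]) ∩ timeShift (t.length + 1) ⁻¹' A) *
        markovMeasure P (cylinderOfString (s ++ [b])) := by
  have hinter (s u : List Bool) : cylinderOfString (s ++ [b]) ∩
      timeShift (s.length + 1) ⁻¹' cylinderOfString u = cylinderOfString (s ++ [b] ++ u) := by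
    ext ω
    rw [mem_cylinderOfString_append, List.length_append, List.length_singleton]
    rfl
  have hcyl (u : List Bool) : markovMeasure P (cylinderOfString (s ++ [b] ++ u)) *
        markovMeasure P (cylinderOfString (t ++ [b])) =
      markovMeasure P (cylinderOfString (t ++ [b] ++ u)) *
        markovMeasure P (cylinderOfString (s ++ [b])) := by
    induction u using List.reverseRecOn with
    | nil => simp only [List.append_nil, mul_comm]
    | append_singleton u a ih =>
      -- The last letter before `a` is the same after both pasts, so both sides gain the same
      -- factor.
      obtain ⟨v, e, hv⟩ : ∃ v e, [b] ++ u = v ++ [e] := by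
        rcases u.eq_nil_or_concat with rfl | ⟨v, e, rfl⟩
        · exact ⟨[], b, rfl⟩
        · exact ⟨b :: v, e, by simp⟩
      have h (s : List Bool) : markovMeasure P (cylinderOfString (s ++ [b] ++ (u ++ [a]))) =
          markovMeasure P (cylinderOfString (s ++ [b] ++ u)) * ENNReal.ofReal (P.1 e a) := by
        rw [← List.append_assoc, List.append_assoc s, hv, ← List.append_assoc,
          markovMeasure_cylinderOfString_concat_concat]
      rw [h, h, mul_right_comm, ih, mul_right_comm]
  let μ (s t : List Bool) : Measure History := markovMeasure P (cylinderOfString (t ++ [b])) •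
    ((markovMeasure P).restrict (cylinderOfString (s ++ [b]))).map (timeShift (s.length + 1))
  have hμ (s t : List Bool) {A : Set History} (hA : MeasurableSet A) : μ s t A =
      markovMeasure P (cylinderOfString (s ++ [b]) ∩ timeShift (s.length + 1) ⁻¹' A) *
        markovMeasure P (cylinderOfString (t ++ [b])) := by
    simp only [μ, Measure.smul_apply, smul_eq_mul]
    rw [Measure.map_apply (measurable_timeShift _) hA,
      Measure.restrict_apply (measurable_timeShift _ hA), Set.inter_comm, mul_comm]
  have : IsFiniteMeasure (μ s t) := ⟨by
    rw [hμ s t MeasurableSet.univ]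
    exact ENNReal.mul_lt_top (measure_lt_top _ _) (measure_lt_top _ _)⟩
  rw [← hμ s t hA, ← hμ t s hA]
  congr 1
  refine measure_ext_of_cylinderOfString fun u => ?_
  rw [hμ s t (measurableSet_cylinderOfString u), hμ t s (measurableSet_cylinderOfString u),
    hinter, hinter, hcyl]

/-- Compare the past `x` with the bare state at time 0, which stationarity carries to time `n`. -/
theorem markovMeasure_cylinderOf_inter_preimage_timeShift (P : TransitionMatrix) {n : ℕ}
    (x : Fin (n + 1) → Bool) {A : Set History} (hA : MeasurableSet A) :
    markovMeasure P (cylinderOf x ∩ timeShift (n + 1) ⁻¹' A) *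
        markovMeasure P {ω | ω n = x (Fin.last n)} =
      markovMeasure P ({ω | ω n = x (Fin.last n)} ∩ timeShift (n + 1) ⁻¹' A) *
        markovMeasure P (cylinderOf x) := by
  set b := x (Fin.last n)
  set s := List.ofFn fun i : Fin n => x i.castSucc with hs
  have hlen : s.length = n := by simp [hs]
  have e1 : cylinderOf x = cylinderOfString (s ++ [b]) := by
    rw [cylinderOf_eq_cylinderOfString, List.ofFn_succ_last]
  have hshift := (hasStationaryLaw_markovMeasure P).measurePreserving_timeShift n
  have e2 : {ω : History | ω n = b} = timeShift n ⁻¹' cylinderOfString [b] := by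
    ext ω
    simp [timeShift]
  have e3 : {ω : History | ω n = b} ∩ timeShift (n + 1) ⁻¹' A =
      timeShift n ⁻¹' (cylinderOfString [b] ∩ timeShift 1 ⁻¹' A) := by
    rw [e2, Set.preimage_inter, ← Set.preimage_comp]
    congr 2
    funext ω
    simp [timeShift_timeShift, add_comm]
  have hmeas := measurableSet_cylinderOfString [b]
  rw [e3, e1, e2, hshift.measure_preimage hmeas.nullMeasurableSet, hshift.measure_preimage
    (hmeas.inter (measurable_timeShift 1 hA)).nullMeasurableSet]
  have := markovMeasure_inter_preimage_timeShift P s [] b hA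
  rwa [hlen] at this

/-! ### Conditioning on the star law -/

theorem cond_starLaw_eq {Cr : Measure History} [IsFiniteMeasure Cr] {γ : Measure History}
    (h : ∀ A, MeasurableSet A → Cr (starLaw γ ∩ A) = Cr (starLaw γ) * γ A)
    (h0 : Cr (starLaw γ) ≠ 0) : Cr[|starLaw γ] = γ := by
  refine Measure.ext fun A hA => ?_
  rw [cond_apply (measurableSet_starLaw _), h A hA, ← mul_assoc,
    ENNReal.inv_mul_cancel h0 (measure_ne_top _ _), one_mul]

/-- The weight of the star law cancels in both conditional probabilities, which leaves the Markov
property of γ_P. -/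
theorem cond_starLaw_cylinderOf_eq {Cr : Measure History} [IsFiniteMeasure Cr]
    {P : TransitionMatrix}
    (h : ∀ A, MeasurableSet A → Cr (starLaw (markovMeasure P) ∩ A) =
      Cr (starLaw (markovMeasure P)) * markovMeasure P A)
    {n : ℕ} (x : Fin (n + 1) → Bool) {A : Set History} (hA : MeasurableSet A)
    (h0 : Cr (starLaw (markovMeasure P) ∩ cylinderOf x) ≠ 0) :
    Cr[timeShift (n + 1) ⁻¹' A | starLaw (markovMeasure P) ∩ cylinderOf x] =
      Cr[timeShift (n + 1) ⁻¹' A |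
        starLaw (markovMeasure P) ∩ {ω | ω n = x (Fin.last n)}] := by
  have hx : MeasurableSet (cylinderOf x) := by
    rw [cylinderOf_eq_cylinderOfString]
    exact measurableSet_cylinderOfString _
  have hn : MeasurableSet {ω : History | ω n = x (Fin.last n)} :=
    measurable_pi_apply n (measurableSet_singleton _)
  have hA' := measurable_timeShift (n + 1) hA
  have hM := measurableSet_starLaw (markovMeasure P)
  have hmul := markovMeasure_cylinderOf_inter_preimage_timeShift P x hA
  rw [h _ hx, mul_ne_zero_iff] at h0
  have hle : markovMeasure P (cylinderOf x) ≤ markovMeasure P {ω | ω n = x (Fin.last n)} :=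
    measure_mono fun ω hω => hω (Fin.last n)
  have h0' : markovMeasure P {ω | ω n = x (Fin.last n)} ≠ 0 := fun h' =>
    h0.2 (nonpos_iff_eq_zero.1 (h' ▸ hle))
  rw [cond_apply (hM.inter hx), cond_apply (hM.inter hn), Set.inter_assoc, Set.inter_assoc,
    h _ hx, h _ hn, h _ (hx.inter hA'), h _ (hn.inter hA'), mul_comm _⁻¹, mul_comm _⁻¹,
    ← div_eq_mul_inv, ← div_eq_mul_inv, ENNReal.mul_div_mul_left _ _ h0.1 (measure_ne_top _ _),
    ENNReal.mul_div_mul_left _ _ h0.1 (measure_ne_top _ _),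
    ENNReal.div_eq_div_iff h0' (measure_ne_top _ _) h0.2 (measure_ne_top _ _), mul_comm, hmul,
    mul_comm]

/-! ### The main theorem -/

theorem mainTheorem3 (P_M : TransitionMatrix) (hP_M : IsComputableMeasure (markovMeasure P_M))
    (w_I w_M : ℝ≥0∞) (hw : w_I + w_M = 1) :
    -- The two models, given by their symmetries.
    (∀ ν_I ν_M : Measure History, IsProbabilityMeasure ν_I → IsProbabilityMeasure ν_M →
      IsExchangeable ν_I → HasStationaryLaw ν_M → IsMarkovExchangeable ν_M →
      ∀ Cr : Measure History, Cr = w_I • ν_I + w_M • ν_M →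
        (Cr (starLaw (markovMeasure P_M)) ≠ 0 →
          Cr[|starLaw (markovMeasure P_M)] = markovMeasure P_M) ∧
        ((∀ θ, markovMeasure P_M ≠ iidMeasure θ) →
          ν_I (starLaw (markovMeasure P_M)) = 0) ∧
        (∀ (n : ℕ) (x : Fin (n + 1) → Bool) (A : Set History), MeasurableSet A →
          Cr (starLaw (markovMeasure P_M) ∩ cylinderOf x) ≠ 0 →
          Cr[timeShift (n + 1) ⁻¹' A | starLaw (markovMeasure P_M) ∩ cylinderOf x] =
            Cr[timeShift (n + 1) ⁻¹' A |
              starLaw (markovMeasure P_M) ∩ {ω | ω n = x (Fin.last n)}]) ∧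
        (Cr (starLaw (iidMeasure halfProb)) ≠ 0 →
          Cr[|starLaw (iidMeasure halfProb)] = iidMeasure halfProb)) ∧
    -- The two models, given by their integral representations.
    (∀ (μ_I : Measure I) (μ_S : Measure TransitionMatrix),
      IsProbabilityMeasure μ_I → IsProbabilityMeasure μ_S →
      ∀ Cr : Measure History,
        (∀ X, MeasurableSet X → Cr X =
          w_I * ∫⁻ θ, iidMeasure θ X ∂μ_I + w_M * ∫⁻ P, markovMeasure P X ∂μ_S) →
        (Cr (starLaw (markovMeasure P_M)) ≠ 0 →
          Cr[|starLaw (markovMeasure P_M)] = markovMeasure P_M) ∧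
        ((∀ θ, markovMeasure P_M ≠ iidMeasure θ) →
          ∫⁻ θ, iidMeasure θ (starLaw (markovMeasure P_M)) ∂μ_I = 0) ∧
        (∀ (n : ℕ) (x : Fin (n + 1) → Bool) (A : Set History), MeasurableSet A →
          Cr (starLaw (markovMeasure P_M) ∩ cylinderOf x) ≠ 0 →
          Cr[timeShift (n + 1) ⁻¹' A | starLaw (markovMeasure P_M) ∩ cylinderOf x] =
            Cr[timeShift (n + 1) ⁻¹' A |
              starLaw (markovMeasure P_M) ∩ {ω | ω n = x (Fin.last n)}]) ∧
        (Cr (starLaw (iidMeasure halfProb)) ≠ 0 →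
          Cr[|starLaw (iidMeasure halfProb)] = iidMeasure halfProb) ∧
        (μ_S {P | markovMeasure P = iidMeasure halfProb} = 0 →
          ∫⁻ P, markovMeasure P (starLaw (iidMeasure halfProb)) ∂μ_S = 0)) := by
  have star_iid (θ : I) {P : TransitionMatrix} {A : Set History} (hA : MeasurableSet A) :
      iidMeasure θ (starLaw (markovMeasure P) ∩ A) =
        iidMeasure θ (starLaw (markovMeasure P)) * markovMeasure P A :=
    (isExchangeable_iidMeasure θ).hasStationaryLaw.measure_starLaw_inter P hA
  have star_markov (Q : TransitionMatrix) {P : TransitionMatrix} {A : Set History}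
      (hA : MeasurableSet A) : markovMeasure Q (starLaw (markovMeasure P) ∩ A) =
        markovMeasure Q (starLaw (markovMeasure P)) * markovMeasure P A :=
    (hasStationaryLaw_markovMeasure Q).measure_starLaw_inter P hA
  obtain ⟨P_L, hP_L⟩ := exists_markovMeasure_eq_iidMeasure_halfProb
  rw [← hP_L]
  refine ⟨fun ν_I ν_M _ _ hI hS _ Cr hCr => ?_, fun μ_I μ_S _ _ Cr hCr => ?_⟩
  · have hfin : IsFiniteMeasure Cr := ⟨by simp [hCr, hw]⟩
    have key (P : TransitionMatrix) (A : Set History) (hA : MeasurableSet A) :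
        Cr (starLaw (markovMeasure P) ∩ A) =
          Cr (starLaw (markovMeasure P)) * markovMeasure P A := by
      simp only [hCr, Measure.add_apply, Measure.smul_apply, smul_eq_mul,
        hI.hasStationaryLaw.measure_starLaw_inter P hA, hS.measure_starLaw_inter P hA]
      ring
    refine ⟨cond_starLaw_eq (key P_M), fun h => ?_,
      fun n x A hA h0 => cond_starLaw_cylinderOf_eq (key P_M) x hA h0, cond_starLaw_eq (key P_L)⟩
    by_contra h0
    obtain ⟨θ, hθ⟩ := hI.exists_markovMeasure_eq_iidMeasure h0
    exact h θ hθ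
  · have hfin : IsFiniteMeasure Cr := ⟨by simp [hCr _ MeasurableSet.univ, hw]⟩
    have key (P : TransitionMatrix) (A : Set History) (hA : MeasurableSet A) :
        Cr (starLaw (markovMeasure P) ∩ A) =
          Cr (starLaw (markovMeasure P)) * markovMeasure P A := by
      have hM := measurableSet_starLaw (markovMeasure P)
      -- The factor γ_P(A) is a finite constant, so it leaves the integrals without any
      -- measurability of the integrands.
      simp only [hCr _ hM, hCr _ (hM.inter hA), star_iid _ hA, star_markov _ hA,
        lintegral_mul_const' _ _ (measure_ne_top (markovMeasure P) A)]
      ring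
    refine ⟨cond_starLaw_eq (key P_M), fun h => ?_,
      fun n x A hA h0 => cond_starLaw_cylinderOf_eq (key P_M) x hA h0, cond_starLaw_eq (key P_L),
      fun h0 => ?_⟩
    · refine (lintegral_congr fun θ => ?_).trans lintegral_zero
      by_contra h0
      obtain ⟨θ', hθ'⟩ := (isExchangeable_iidMeasure θ).exists_markovMeasure_eq_iidMeasure h0
      exact h θ' hθ'
    -- The integrand can be nonzero only at those `P` whose γ_P is the fair-coin measure.
    · refine lintegral_eq_zero_of_ae_eq_zero (measure_mono_null (fun P hP => ?_) h0)
      exact markovMeasure_eq_of_measure_starLaw_ne_zero hP
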